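/- Let $X$ be a path-connected CW complex with base point $x_0$, let $\pi=\pi_1(X,x_0)$, and let $P:\widetilde X\to X$ be the universal cover, on which $\pi$ acts by deck transformations. For $n\ge 2$ let $\prod_\pi\widetilde X$ be the quotient of $\widetilde X^n$ by the diagonal action of $\pi$, and let $q:\prod_\pi\widetilde X\to X^n$, $q([x_1,\dots,x_n])=(Px_1,\dots,Px_n)$. Let $$E=\{(\omega,x_1,\dots,x_n):\ \omega\in\widetilde X^{[0,1]},\ \omega(\tfrac{j-1}{n-1})=x_j \text{ for } 1\le j\le n\}/\pi,$$ that is, the space $\widetilde X^{[0,1]}$ of paths in $\widetilde X$ (with the compact-open topology) modulo $\pi$, which $[\omega]\mapsto P\circ\omega$ identifies with the free path space $X^{[0,1]}$. Let $p:E\to\prod_\pi\widetilde X$, $p([\omega])=[\omega(0),\omega(\tfrac1{n-1}),\dots,\omega(1)]$. Define $\widetilde{\operatorname{TC}}_n(X)$ to be the least integer $k\ge 1$ such that $X^n$ has an open cover $X^n=U_1\cup\dots\cup U_k$ for which $p$ admits a continuous section over each $q^{-1}(U_i)$ (and $\widetilde{\operatorname{TC}}_n(X)=\infty$ if there is no such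 $k$). Then the following are equivalent: (i) $\widetilde{\operatorname{TC}}_n(X)=1$ for some $n\ge 2$; (ii) $X$ is aspherical, i.e. $\pi_r(X)=0$ for all $r\ge 2$; (iii) $\widetilde{\operatorname{TC}}_n(X)=1$ for all $n\ge 2$. -/

import Mathlib

open scoped unitInterval Topology

noncomputable section

universe u v w

/-- A point of the universal cover of `X` based at `x₀`: the homotopy class, relative to the
endpoints, of a path in `X` that starts at `x₀`. -/
@[ext]
structure UniversalCover (X : Type u) [TopologicalSpace X] (x₀ : X) where
  /-- The endpoint of the path. -/
  pt : X
  /-- The homotopy class of the path. -/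
  cls : Path.Homotopic.Quotient x₀ pt

namespace UniversalCover

variable {X : Type u} [TopologicalSpace X] {x₀ : X}

/-- The covering projection `P`, which sends the class of a path to its endpoint. -/
def proj (a : UniversalCover X x₀) : X := a.pt

/-- The basic set `[γ]U`: all classes `[γ · η]` with `η` a path in `U` that starts at the
endpoint of `γ`. -/
def basicNhd (a : UniversalCover X x₀) (U : Set X) : Set (UniversalCover X x₀) :=
  {b | ∃ η : Path a.pt b.pt, (∀ t, η t ∈ U) ∧
    b.cls = a.cls.trans (Path.Homotopic.Quotient.mk η)}

/-- The usual topology of the universal cover, generated by the sets `[γ]U` with `U` an open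
neighbourhood of the endpoint of `γ`. -/
instance : TopologicalSpace (UniversalCover X x₀) :=
  TopologicalSpace.generateFrom
    {S | ∃ (a : UniversalCover X x₀) (U : Set X), IsOpen U ∧ a.pt ∈ U ∧ S = basicNhd a U}

/-- The action of the fundamental group by deck transformations, by composition with a loop at
the front. Mathlib's product in `FundamentalGroup X x₀` is composition of loops in the reverse
order, so a left action has to use the inverse loop. -/
instance : MulAction (FundamentalGroup X x₀) (UniversalCover X x₀) where
  smul g a := ⟨a.pt, Path.Homotopic.Quotient.trans (FundamentalGroup.toPath g⁻¹) a.cls⟩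
  one_smul a := by
    change UniversalCover.mk a.pt (Path.Homotopic.Quotient.trans
      (FundamentalGroup.toPath (1 : FundamentalGroup X x₀)⁻¹) a.cls) = a
    rw [inv_one, FundamentalGroup.one_def]
    exact congrArg (UniversalCover.mk a.pt) (Path.Homotopic.Quotient.refl_trans a.cls)
  mul_smul g h a := by
    change UniversalCover.mk a.pt (Path.Homotopic.Quotient.trans
        (FundamentalGroup.toPath (g * h)⁻¹) a.cls) =
      UniversalCover.mk a.pt (Path.Homotopic.Quotient.trans (FundamentalGroup.toPath g⁻¹)
        (Path.Homotopic.Quotient.trans (FundamentalGroup.toPath h⁻¹) a.cls))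
    rw [mul_inv_rev, FundamentalGroup.mul_def]
    exact congrArg (UniversalCover.mk a.pt) (Path.Homotopic.Quotient.trans_assoc _ _ _)

@[simp]
theorem smul_pt (g : FundamentalGroup X x₀) (a : UniversalCover X x₀) : (g • a).pt = a.pt := rfl

theorem smul_cls (g : FundamentalGroup X x₀) (a : UniversalCover X x₀) :
    (g • a).cls = Path.Homotopic.Quotient.trans (FundamentalGroup.toPath g⁻¹) a.cls := rfl

theorem smul_mem_basicNhd (g : FundamentalGroup X x₀) {a b : UniversalCover X x₀} {U : Set X}
    (h : b ∈ basicNhd a U) : g • b ∈ basicNhd (g • a) U := by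
  obtain ⟨η, hη, hb⟩ := h
  refine ⟨η, hη, ?_⟩
  rw [smul_cls, hb]
  exact (Path.Homotopic.Quotient.trans_assoc _ _ _).symm

instance : ContinuousConstSMul (FundamentalGroup X x₀) (UniversalCover X x₀) where
  continuous_const_smul g := by
    refine continuous_generateFrom_iff.2 ?_
    rintro S ⟨a, U, hU, ha, rfl⟩
    have h : (fun x => g • x) ⁻¹' basicNhd a U = basicNhd (g⁻¹ • a) U := by
      ext b
      constructor
      · intro hb
        simpa using smul_mem_basicNhd g⁻¹ hb
      · intro hb
        simpa using smul_mem_basicNhd g hb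
    rw [h]
    exact TopologicalSpace.isOpen_generateFrom_of_mem ⟨g⁻¹ • a, U, hU, ha, rfl⟩

end UniversalCover

/-- For maps `p : E → Y` and `q : Y → B`, the least `k ≥ 1` such that `B` has a cover by `k` open
sets `U i` for which `p` has a continuous section over each `q ⁻¹' U i`; it is `⊤` if there is no
such `k`. -/
def secatTilde {E : Type u} {Y : Type v} {B : Type w}
    [TopologicalSpace E] [TopologicalSpace Y] [TopologicalSpace B]
    (p : E → Y) (q : Y → B) : ℕ∞ :=
  sInf {m : ℕ∞ | ∃ k : ℕ, m = (k : ℕ∞) ∧ 1 ≤ k ∧ ∃ U : Fin k → Set B,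
    (∀ i, IsOpen (U i)) ∧ (⋃ i, U i) = Set.univ ∧
      ∀ i, ∃ s : C(q ⁻¹' U i, E), ∀ y : q ⁻¹' U i, p (s y) = y}

/-- The point `j / (n - 1)` of the unit interval, for `j = 0, …, n - 1`. -/
def gridPoint (n : ℕ) (j : Fin n) : I :=
  ⟨(j : ℝ) / ((n : ℝ) - 1), by
    have h : (j : ℝ) + 1 ≤ (n : ℝ) := by exact_mod_cast j.isLt
    have h0 : (0 : ℝ) ≤ (j : ℝ) := Nat.cast_nonneg _
    exact ⟨div_nonneg h0 (by linarith), div_le_one_of_le₀ (by linarith) (by linarith)⟩⟩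

section HigherTC

variable (n : ℕ) (X : Type u) [TopologicalSpace X] (x₀ : X)

/-- The quotient of the `n`-fold product of the universal cover by the diagonal action of the
fundamental group. -/
abbrev DiagonalQuotient : Type u :=
  MulAction.orbitRel.Quotient (FundamentalGroup X x₀) (Fin n → UniversalCover X x₀)

/-- The space of paths `ω` in the universal cover modulo the fundamental group, with the quotient
of the compact-open topology. It is the space of orbits `[ω, x₁, …, xₙ]` with
`ω (j / (n - 1)) = xⱼ₊₁`, as the points `xⱼ` are determined by `ω`, and `[ω] ↦ P ∘ ω` identifies
it with the free path space of `X`. -/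
abbrev PathQuotient : Type u :=
  MulAction.orbitRel.Quotient (FundamentalGroup X x₀) C(I, UniversalCover X x₀)

/-- The map `p`, which sends `[ω]` to `[ω 0, ω (1 / (n - 1)), …, ω 1]`. -/
def pathEvaluation : PathQuotient X x₀ → DiagonalQuotient n X x₀ :=
  Quotient.map' (fun ω j => ω (gridPoint n j)) (by
    rintro ω ω' ⟨g, rfl⟩
    exact ⟨g, rfl⟩)

/-- The map `q`, which sends `[x₁, …, xₙ]` to `(P x₁, …, P xₙ)`. -/
def diagonalProjection : DiagonalQuotient n X x₀ → (Fin n → X) :=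
  Quotient.lift (fun x j => (x j).proj) (by
    rintro x x' ⟨g, rfl⟩
    rfl)

/-- The invariant `TC̃ₙ(X)`. -/
def tcTilde : ℕ∞ :=
  secatTilde (pathEvaluation n X x₀) (diagonalProjection n X x₀)

end HigherTC

/-- A path-connected space is aspherical if its homotopy groups in degrees at least two vanish. -/
def IsAspherical (X : Type u) [TopologicalSpace X] : Prop :=
  PathConnectedSpace X ∧ ∀ r : ℕ, 2 ≤ r → ∀ x : X, Subsingleton (π_ r X x)

end

/-! Write E for the universal cover. The value 1 means exactly that p has a global section
(`secatTilde_eq_one_iff`), and a global section amounts to a continuous π-equivariant choice of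
paths in E through n prescribed points.

From (i) to (ii): evaluate the section at the classes of (a,…,a,x). Because π acts freely, each
resulting class of paths has a representative in E running from a to x, and these representatives
depend continuously on x. They contract E to a (`exists_contraction_of_section`). Hence the homotopy
groups of E vanish, and since maps of cubes of dimension at least 2 lift, so do the higher groups of
X.

From (ii) to (iii): it suffices to find a continuous equivariant choice of paths between two points
of E, since such paths can be concatenated through n points. E × E is covered by freely permuted
product cells, and as E has no homotopy, paths with prescribed ends extend from the boundary of each
product cell to its interior (`exists_path_extension`, `exists_equivariant_section`). The obstacle
is that E × E need not carry the weak topology of these cells, so the choice τ obtained in this way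
is only known to be continuous on suitable compact sets (`exists_equivariant_paths`).

The remedy is a homotopy of X, starting at the identity, whose final map factors near every point
through a single closed ball (`exists_deformation`). Its equivariant lift H sends a neighbourhood of
every point of E into a compact set over finitely many cells, so (x,y) ↦ τ(H₁x, H₁y) is continuous.
Following H from x, then τ, then H backwards to y gives the required paths
(`exists_continuous_equivariant_paths`). The same homotopy shows that X is semilocally simply
connected (`hasHomotopicPathsNhds`), which makes E a simply connected covering in both directions of
the proof. -/

/-- Every point has an open neighbourhood in which paths with common endpoints are homotopic in
the ambient space. -/
def HasHomotopicPathsNhds (X : Type u) [TopologicalSpace X] : Prop :=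
  ∀ x : X, ∃ V : Set X, IsOpen V ∧ x ∈ V ∧
    ∀ (y z : X) (p q : Path y z), (∀ t, p t ∈ V) → (∀ t, q t ∈ V) → p.Homotopic q

/-! ### The universal cover: covering property, path lifting, simple connectivity. -/

namespace UniversalCover

variable {X : Type u} [TopologicalSpace X] {x₀ : X}

theorem mem_basicNhd_self (a : UniversalCover X x₀) {U : Set X} (h : a.pt ∈ U) :
    a ∈ basicNhd a U :=
  ⟨Path.refl _, fun _ => h, by
    rw [Path.Homotopic.Quotient.mk_refl, Path.Homotopic.Quotient.trans_refl]⟩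

theorem pt_mem_of_mem_basicNhd {a b : UniversalCover X x₀} {U : Set X} (h : b ∈ basicNhd a U) :
    b.pt ∈ U := by
  obtain ⟨η, hη, -⟩ := h
  simpa using hη 1

theorem basicNhd_mono {a : UniversalCover X x₀} {U V : Set X} (h : U ⊆ V) :
    basicNhd a U ⊆ basicNhd a V := by
  rintro b ⟨η, hη, hb⟩
  exact ⟨η, fun t => h (hη t), hb⟩

theorem basicNhd_trans {a b c : UniversalCover X x₀} {U : Set X} (hb : b ∈ basicNhd a U)
    (hc : c ∈ basicNhd b U) : c ∈ basicNhd a U := by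
  obtain ⟨η, hη, hb⟩ := hb
  obtain ⟨θ, hθ, hc⟩ := hc
  refine ⟨η.trans θ, fun t => ?_, ?_⟩
  · rw [Path.trans_apply]
    split_ifs
    exacts [hη _, hθ _]
  · rw [hc, hb, Path.Homotopic.Quotient.mk_trans, Path.Homotopic.Quotient.trans_assoc]

theorem isOpen_basicNhd (a : UniversalCover X x₀) {U : Set X} (hU : IsOpen U) :
    IsOpen (basicNhd a U) := by
  by_cases h : a.pt ∈ U
  · exact TopologicalSpace.isOpen_generateFrom_of_mem ⟨a, U, hU, h, rfl⟩
  · have : basicNhd a U = ∅ := by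
      refine Set.eq_empty_of_forall_notMem fun b ⟨η, hη, _⟩ => h ?_
      simpa using hη 0
    rw [this]
    exact isOpen_empty

/-- A basic set can be recentred at any of its points, so the generating sets behave like a
neighbourhood base. -/
theorem exists_basicNhd_subset {S : Set (UniversalCover X x₀)} (hS : IsOpen S)
    {c : UniversalCover X x₀} (hc : c ∈ S) :
    ∃ U : Set X, IsOpen U ∧ c.pt ∈ U ∧ basicNhd c U ⊆ S := by
  induction hS with
  | basic s hs =>
    obtain ⟨a, U, hU, -, rfl⟩ := hs
    exact ⟨U, hU, pt_mem_of_mem_basicNhd hc, fun b hb => basicNhd_trans hc hb⟩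
  | univ => exact ⟨Set.univ, isOpen_univ, trivial, Set.subset_univ _⟩
  | inter s t _ _ hs ht =>
    obtain ⟨U, hU, hcU, hUs⟩ := hs hc.1
    obtain ⟨V, hV, hcV, hVt⟩ := ht hc.2
    exact ⟨U ∩ V, hU.inter hV, ⟨hcU, hcV⟩, fun b hb =>
      ⟨hUs (basicNhd_mono Set.inter_subset_left hb),
        hVt (basicNhd_mono Set.inter_subset_right hb)⟩⟩
  | sUnion S _ ih =>
    obtain ⟨s, hs, hcs⟩ := hc
    obtain ⟨U, hU, hcU, hUs⟩ := ih s hs hcs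
    exact ⟨U, hU, hcU, hUs.trans (Set.subset_sUnion_of_mem hs)⟩

theorem continuous_proj : Continuous (proj : UniversalCover X x₀ → X) := by
  refine ⟨fun U hU => ?_⟩
  have : proj ⁻¹' U = ⋃ a : {a : UniversalCover X x₀ // a.pt ∈ U}, basicNhd a.1 U := by
    ext b
    simp only [Set.mem_preimage, Set.mem_iUnion, Subtype.exists]
    exact ⟨fun h => ⟨b, h, mem_basicNhd_self b h⟩, fun ⟨a, _, h⟩ => pt_mem_of_mem_basicNhd h⟩
  rw [this]
  exact isOpen_iUnion fun a => isOpen_basicNhd _ hU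

theorem isOpenMap_proj [LocallyPathConnectedSpace X] :
    IsOpenMap (proj : UniversalCover X x₀ → X) := by
  intro S hS
  rw [isOpen_iff_mem_nhds]
  rintro _ ⟨c, hc, rfl⟩
  obtain ⟨U, hU, hcU, hUS⟩ := exists_basicNhd_subset hS hc
  -- The image of `basicNhd c U` is the path component of `c.pt` in `U`, which is open by local
  -- path-connectedness.
  refine Filter.mem_of_superset ((hU.pathComponentIn c.pt).mem_nhds
    (mem_pathComponentIn_self hcU)) ?_
  rintro y ⟨η, hη⟩
  exact ⟨⟨y, c.cls.trans (Path.Homotopic.Quotient.mk η)⟩, hUS ⟨η, hη, rfl⟩, rfl⟩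

theorem surjective_proj [PathConnectedSpace X] :
    Function.Surjective (proj : UniversalCover X x₀ → X) := fun x =>
  ⟨⟨x, Path.Homotopic.Quotient.mk (PathConnectedSpace.somePath x₀ x)⟩, rfl⟩

theorem proj_eq_iff_mem_orbit {a b : UniversalCover X x₀} :
    a.proj = b.proj ↔ a ∈ MulAction.orbit (FundamentalGroup X x₀) b := by
  constructor
  · obtain ⟨x, α⟩ := a
    obtain ⟨y, β⟩ := b
    rintro (rfl : x = y)
    refine ⟨(FundamentalGroup.fromPath (α.trans β.symm))⁻¹, ?_⟩
    refine UniversalCover.ext rfl (heq_of_eq ?_)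
    change Path.Homotopic.Quotient.trans (FundamentalGroup.toPath
      (FundamentalGroup.fromPath (α.trans β.symm))⁻¹⁻¹) β = α
    rw [inv_inv]
    change Path.Homotopic.Quotient.trans (α.trans β.symm) β = α
    rw [Path.Homotopic.Quotient.trans_assoc, Path.Homotopic.Quotient.symm_trans,
      Path.Homotopic.Quotient.trans_refl]
  · rintro ⟨g, rfl⟩
    rfl

theorem eq_one_of_smul_cls_eq {g : FundamentalGroup X x₀} {a : UniversalCover X x₀}
    (h : (g • a).cls = a.cls) : g = 1 := by
  rw [smul_cls] at h
  have h1 : FundamentalGroup.toPath g⁻¹ = Path.Homotopic.Quotient.refl x₀ := by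
    calc FundamentalGroup.toPath g⁻¹
        = ((FundamentalGroup.toPath g⁻¹).trans a.cls).trans a.cls.symm := by
          rw [Path.Homotopic.Quotient.trans_assoc, Path.Homotopic.Quotient.trans_symm,
            Path.Homotopic.Quotient.trans_refl]
      _ = Path.Homotopic.Quotient.refl x₀ := by rw [h, Path.Homotopic.Quotient.trans_symm]
  have h2 : g⁻¹ = 1 := h1
  exact inv_eq_one.1 h2

/-- If a point of `basicNhd e V` and its translate by `g` both lie in that set, their classes arise
from `e.cls` by appending paths in `V` with the same endpoints. These are homotopic in `X`, so `g`
fixes a class and is trivial. -/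
theorem isQuotientCoveringMap_proj [PathConnectedSpace X] [LocallyPathConnectedSpace X]
    (hX : HasHomotopicPathsNhds X) :
    IsQuotientCoveringMap (proj : UniversalCover X x₀ → X) (FundamentalGroup X x₀) where
  toIsQuotientMap := isOpenMap_proj.isQuotientMap continuous_proj surjective_proj
  continuous_const_smul := continuous_const_smul
  apply_eq_iff_mem_orbit := proj_eq_iff_mem_orbit
  disjoint e := by
    obtain ⟨V, hV, heV, hhV⟩ := hX e.pt
    refine ⟨basicNhd e V, (isOpen_basicNhd e hV).mem_nhds (mem_basicNhd_self e heV), ?_⟩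
    rintro g ⟨_, ⟨c, ⟨η, hη, hc⟩, rfl⟩, ⟨θ, hθ, hgc⟩⟩
    refine eq_one_of_smul_cls_eq (a := c) ?_
    rw [hc, hgc]
    exact congrArg _ (Path.Homotopic.Quotient.eq.2 (hhV _ _ _ _ hθ hη))

theorem t2Space [T2Space X] [PathConnectedSpace X] [LocallyPathConnectedSpace X]
    (hX : HasHomotopicPathsNhds X) : T2Space (UniversalCover X x₀) :=
  ⟨fun a b hab => by
    by_cases h : a.proj = b.proj
    · exact (isQuotientCoveringMap_proj hX).isCoveringMap.isSeparatedMap a b h hab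
    · exact separated_by_continuous continuous_proj h⟩

/-- The lift of a path to the universal cover. -/
noncomputable def pathLift (a : UniversalCover X x₀) {y : X} (η : Path a.pt y) (t : I) :
    UniversalCover X x₀ :=
  ⟨η t, a.cls.trans ((Path.Homotopic.Quotient.mk (η.subpath 0 t)).cast η.source.symm rfl)⟩

/-- For `s` near `t` the lift at `s` is the lift at `t` followed by the short piece of `η` from `t`
to `s`, which stays in the given `U`. -/
theorem continuous_pathLift (a : UniversalCover X x₀) {y : X} (η : Path a.pt y) :
    Continuous (pathLift a η) := by
  rw [continuous_iff_continuousAt]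
  intro t
  rw [ContinuousAt, Filter.tendsto_def]
  intro S hS
  obtain ⟨S', hS'S, hS', htS'⟩ := mem_nhds_iff.1 hS
  obtain ⟨U, hU, htU, hUS⟩ := exists_basicNhd_subset hS' htS'
  obtain ⟨ε, hε, hεU⟩ := Metric.mem_nhds_iff.1 ((hU.preimage η.continuous).mem_nhds htU)
  refine Filter.mem_of_superset (Metric.ball_mem_nhds t hε) fun s hs => hS'S (hUS ?_)
  refine ⟨η.subpath t s, fun r => ?_, ?_⟩
  · have h1 : (η.subpath t s) r ∈ Set.range (η.subpath t s) := ⟨r, rfl⟩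
    rw [Path.range_subpath] at h1
    obtain ⟨r', hr', hr⟩ := h1
    refine (congrArg (· ∈ U) hr).mp (hεU ?_)
    refine Metric.mem_ball.2 (lt_of_le_of_lt ?_ (Metric.mem_ball.1 hs))
    have h2 : (r' : ℝ) ∈ Set.uIcc (t : ℝ) s := by
      rw [Set.mem_uIcc] at hr' ⊢
      exact hr'
    exact Set.abs_sub_left_of_mem_uIcc h2
  · have h : ∀ {x y z w : X} (hx : x = y) (α : Path.Homotopic.Quotient y z)
        (β : Path.Homotopic.Quotient z w),
        (α.trans β).cast hx rfl = (α.cast hx rfl).trans β := by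
      rintro x _ z w rfl α β
      rw [Path.Homotopic.Quotient.cast_rfl_rfl, Path.Homotopic.Quotient.cast_rfl_rfl]
    have h1 : Path.Homotopic.Quotient.mk (η.subpath 0 s) =
        (Path.Homotopic.Quotient.mk (η.subpath 0 t)).trans
          (Path.Homotopic.Quotient.mk (η.subpath t s)) :=
      (Path.Homotopic.Quotient.eq.2 ⟨Path.Homotopy.subpathTransSubpath η 0 t s⟩).symm
    have h2 : (Path.Homotopic.Quotient.mk (η.subpath 0 s)).cast η.source.symm rfl =
        ((Path.Homotopic.Quotient.mk (η.subpath 0 t)).cast η.source.symm rfl).trans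
          (Path.Homotopic.Quotient.mk (η.subpath t s)) := by
      rw [h1, h]
    exact (congrArg (Path.Homotopic.Quotient.trans a.cls) h2).trans
      (Path.Homotopic.Quotient.trans_assoc _ _ _).symm

theorem pathLift_zero (a : UniversalCover X x₀) {y : X} (η : Path a.pt y) :
    pathLift a η 0 = a := by
  have h : ∀ (z : X) (hz : a.pt = z) (β : Path.Homotopic.Quotient z z),
      β = Path.Homotopic.Quotient.refl z →
      (⟨z, a.cls.trans (β.cast hz rfl)⟩ : UniversalCover X x₀) = a := by
    rintro z rfl β rfl
    rw [Path.Homotopic.Quotient.cast_rfl_rfl, Path.Homotopic.Quotient.trans_refl]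
  refine h _ η.source.symm _ ?_
  rw [Path.subpath_self, Path.Homotopic.Quotient.mk_refl]

theorem pathLift_one (a : UniversalCover X x₀) {y : X} (η : Path a.pt y) :
    pathLift a η 1 = ⟨y, a.cls.trans (Path.Homotopic.Quotient.mk η)⟩ := by
  have h : ∀ (z : X) (hz : z = y) (β : Path.Homotopic.Quotient a.pt z),
      β = (Path.Homotopic.Quotient.mk η).cast rfl hz →
      (⟨z, a.cls.trans β⟩ : UniversalCover X x₀) =
        ⟨y, a.cls.trans (Path.Homotopic.Quotient.mk η)⟩ := by
    rintro z rfl β rfl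
    rw [Path.Homotopic.Quotient.cast_rfl_rfl]
  refine h _ η.target _ ?_
  rw [Path.subpath_zero_one, Path.Homotopic.Quotient.mk_cast,
    Path.Homotopic.Quotient.cast_cast]

theorem pathConnectedSpace : PathConnectedSpace (UniversalCover X x₀) := by
  have h : ∀ a : UniversalCover X x₀,
      Joined (⟨x₀, Path.Homotopic.Quotient.refl x₀⟩ : UniversalCover X x₀) a := by
    rintro ⟨y, α⟩
    induction α using Path.Homotopic.Quotient.ind with | mk η =>
    refine ⟨⟨⟨_, continuous_pathLift ⟨x₀, Path.Homotopic.Quotient.refl x₀⟩ η⟩, ?_, ?_⟩⟩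
    · exact pathLift_zero ⟨x₀, Path.Homotopic.Quotient.refl x₀⟩ η
    · refine (pathLift_one ⟨x₀, Path.Homotopic.Quotient.refl x₀⟩ η).trans ?_
      rw [Path.Homotopic.Quotient.refl_trans]
  exact ⟨⟨⟨x₀, Path.Homotopic.Quotient.refl x₀⟩⟩, fun a b => (h a).symm.trans (h b)⟩

/-- By unique path lifting, `ω` is the explicit lift `pathLift` of its own projection; compare
endpoints. -/
theorem cls_eq_trans_map [PathConnectedSpace X] [LocallyPathConnectedSpace X]
    (hX : HasHomotopicPathsNhds X) {a b : UniversalCover X x₀} (ω : Path a b) :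
    b = ⟨b.pt, a.cls.trans (Path.Homotopic.Quotient.mk (ω.map continuous_proj))⟩ := by
  have cov := (isQuotientCoveringMap_proj (x₀ := x₀) hX).isCoveringMap
  have h := cov.eq_of_comp_eq ω.continuous (continuous_pathLift a (ω.map continuous_proj)) rfl 0
    (by rw [ω.source]; exact (pathLift_zero a _).symm)
  have h1 := congrFun h 1
  rw [ω.target] at h1
  exact h1.trans (pathLift_one a (ω.map continuous_proj))

/-- For a loop at `a`, the previous lemma lets `a.cls` be cancelled, so the projected loop is
null-homotopic, and a covering map is injective on homotopy classes of paths. -/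
theorem simplyConnectedSpace [PathConnectedSpace X] [LocallyPathConnectedSpace X]
    (hX : HasHomotopicPathsNhds X) : SimplyConnectedSpace (UniversalCover X x₀) := by
  have cov := (isQuotientCoveringMap_proj (x₀ := x₀) hX).isCoveringMap
  refine simply_connected_iff_loops_nullhomotopic.2 ⟨pathConnectedSpace, fun a ω => ?_⟩
  refine Path.Homotopic.Quotient.eq.1 (cov.injective_path_homotopic_map a a ?_)
  have h : a.cls = a.cls.trans (Path.Homotopic.Quotient.mk (ω.map continuous_proj)) :=
    eq_of_heq (UniversalCover.ext_iff.1 (cls_eq_trans_map hX ω)).2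
  have key : ∀ β : Path.Homotopic.Quotient a.pt a.pt, a.cls = a.cls.trans β →
      β = Path.Homotopic.Quotient.refl a.pt := by
    intro β hβ
    have h1 : a.cls.symm.trans (a.cls.trans β) = β := by
      rw [← Path.Homotopic.Quotient.trans_assoc, Path.Homotopic.Quotient.symm_trans,
        Path.Homotopic.Quotient.refl_trans]
    rw [← h1, ← hβ, Path.Homotopic.Quotient.symm_trans]
  exact key _ h

end UniversalCover

/-! ### Filling spheres in a space with vanishing homotopy groups. -/

section SphereFilling

open Metric Set

variable {Y : Type u} [TopologicalSpace Y]

/-- Through `e` the closed unit ball is the cube [-1,1]^N, so `g` is, up to affine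
reparametrisation, a cubical loop. Clamping the coordinates makes the null-homotopy defined and
continuous everywhere. -/
theorem exists_nullhomotopy_of_subsingleton_homotopyGroup {N : ℕ} {V : Type v}
    [NormedAddCommGroup V] (e : V ≃ᵢ (Fin N → ℝ)) (he : e 0 = 0)
    {y : Y} (hY : Subsingleton (HomotopyGroup.Pi N Y y)) {g : V → Y}
    (hg : ContinuousOn g (closedBall 0 1)) (hgy : ∀ z ∈ sphere (0 : V) 1, g z = y) :
    ∃ H : ℝ × V → Y, Continuous H ∧ (∀ z ∈ closedBall (0 : V) 1, H (0, z) = g z) ∧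
      (∀ z, H (1, z) = y) ∧ ∀ t, ∀ z ∈ sphere (0 : V) 1, H (t, z) = y := by
  have hnorm : ∀ z, ‖e z‖ = ‖z‖ := fun z => by
    rw [← dist_zero_right, ← dist_zero_right z, ← he, e.dist_eq]
  let u : (Fin N → I) → V := fun c => e.symm fun i => 2 * (c i : ℝ) - 1
  have hu : Continuous u := by
    refine e.symm.continuous.comp (continuous_pi fun i => ?_)
    fun_prop
  have huball : ∀ c, u c ∈ closedBall (0 : V) 1 := fun c => by
    rw [mem_closedBall_zero_iff, ← hnorm, e.apply_symm_apply]
    refine (pi_norm_le_iff_of_nonneg zero_le_one).2 fun i => ?_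
    rw [Real.norm_eq_abs, abs_le]
    exact ⟨by linarith [(c i).2.1], by linarith [(c i).2.2]⟩
  have hub : ∀ c ∈ Cube.boundary (Fin N), u c ∈ sphere (0 : V) 1 := by
    rintro c ⟨i, hi⟩
    rw [mem_sphere_zero_iff_norm]
    refine le_antisymm (mem_closedBall_zero_iff.1 (huball c)) ?_
    rw [← hnorm, e.apply_symm_apply]
    refine le_trans ?_ (norm_le_pi_norm (fun i => 2 * (c i : ℝ) - 1) i)
    rcases hi with hi | hi <;> norm_num [hi]
  let γ : GenLoop (Fin N) Y y := ⟨⟨fun c => g (u c), hg.comp_continuous hu huball⟩,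
    fun c hc => hgy _ (hub c hc)⟩
  obtain ⟨F⟩ : GenLoop.Homotopic γ GenLoop.const :=
    Quotient.exact (Subsingleton.elim (α := HomotopyGroup.Pi N Y y) ⟦γ⟧ ⟦GenLoop.const⟧)
  let d : V → Fin N → I := fun z i => projIcc 0 1 zero_le_one ((e z i + 1) / 2)
  have hd : Continuous d := by
    refine continuous_pi fun i => continuous_projIcc.comp ?_
    have := (continuous_apply i).comp e.continuous
    exact (this.add continuous_const).div_const 2
  have hud : ∀ z ∈ closedBall (0 : V) 1, u (d z) = z := by
    intro z hz
    rw [mem_closedBall_zero_iff, ← hnorm, pi_norm_le_iff_of_nonneg zero_le_one] at hz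
    refine e.symm_apply_eq.2 (funext fun i => ?_)
    have hi := abs_le.1 (hz i)
    have : ((d z i : I) : ℝ) = (e z i + 1) / 2 :=
      congrArg Subtype.val (projIcc_of_mem zero_le_one
        (show (e z i + 1) / 2 ∈ Icc (0 : ℝ) 1 from ⟨by linarith, by linarith⟩))
    rw [this]
    ring
  have hdb : ∀ z ∈ sphere (0 : V) 1, d z ∈ Cube.boundary (Fin N) := by
    intro z hz
    rw [mem_sphere_zero_iff_norm, ← hnorm] at hz
    have : ∃ i, 1 ≤ ‖e z i‖ := by
      by_contra! h
      exact absurd hz (ne_of_lt ((pi_norm_lt_iff zero_lt_one).2 h))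
    obtain ⟨i, hi⟩ := this
    refine ⟨i, ?_⟩
    rcases le_abs.1 hi with h | h
    · exact Or.inr (projIcc_of_right_le _ (by linarith))
    · exact Or.inl (projIcc_of_le_left _ (by linarith))
  refine ⟨fun p => F (projIcc 0 1 zero_le_one p.1, d p.2),
    F.continuous.comp ((continuous_projIcc.comp continuous_fst).prodMk
      (hd.comp continuous_snd)), fun z hz => ?_, fun z => ?_, fun t z hz => ?_⟩
  · have : F (projIcc 0 1 zero_le_one (0 : ℝ), d z) = γ (d z) := by
      rw [projIcc_left]
      exact F.apply_zero _
    refine this.trans ?_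
    change g (u (d z)) = g z
    rw [hud z hz]
  · have : F (projIcc 0 1 zero_le_one (1 : ℝ), d z) = GenLoop.const (X := Y) (x := y) (d z) := by
      rw [projIcc_right]
      exact F.apply_one _
    exact this
  · exact (F.eq_fst _ (hdb z hz)).trans (γ.2 _ (hdb z hz))

/-- Extendability over the ball depends only on the homotopy class: run `K` in the collar 1/2 ≤ ‖w‖
and put a rescaled `F` inside. -/
theorem exists_extend_closedBall_of_homotopy {W : Type v} [NormedAddCommGroup W]
    [NormedSpace ℝ W] {K : ℝ × W → Y} (hK : ContinuousOn K (Icc 0 1 ×ˢ sphere 0 1)) {F : W → Y}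
    (hF : ContinuousOn F (closedBall 0 1)) (hKF : ∀ w ∈ sphere (0 : W) 1, K (1, w) = F w) :
    ∃ G : W → Y, ContinuousOn G (closedBall 0 1) ∧ ∀ w ∈ sphere (0 : W) 1, G w = K (0, w) := by
  classical
  refine ⟨fun w => if 1 / 2 ≤ ‖w‖ then K (2 * (1 - ‖w‖), ‖w‖⁻¹ • w) else F ((2 : ℝ) • w), ?_, ?_⟩
  · have h1 : ContinuousOn (fun w : W => K (2 * (1 - ‖w‖), ‖w‖⁻¹ • w))
        (closedBall 0 1 ∩ {w | 1 / 2 ≤ ‖w‖}) := by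
      refine hK.comp (ContinuousOn.prodMk (f := fun w : W => 2 * (1 - ‖w‖))
        (g := fun w : W => ‖w‖⁻¹ • w) (by fun_prop) ?_) ?_
      · refine ContinuousOn.smul (ContinuousOn.inv₀ (by fun_prop) ?_) continuousOn_id
        rintro w ⟨-, hw : 1 / 2 ≤ ‖w‖⟩
        linarith
      · rintro w ⟨hw1, hw2 : 1 / 2 ≤ ‖w‖⟩
        rw [mem_closedBall_zero_iff] at hw1
        refine ⟨⟨by simpa using hw1, by linarith⟩, ?_⟩
        rw [mem_sphere_zero_iff_norm, norm_smul, norm_inv, norm_norm]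
        exact inv_mul_cancel₀ (by linarith)
    have h2 : ContinuousOn (fun w : W => F ((2 : ℝ) • w))
        (closedBall 0 1 ∩ {w | ‖w‖ ≤ 1 / 2}) := by
      refine hF.comp (by fun_prop : Continuous fun w : W => (2 : ℝ) • w).continuousOn ?_
      rintro w ⟨-, hw : ‖w‖ ≤ 1 / 2⟩
      rw [mem_closedBall_zero_iff, norm_smul]
      norm_num
      linarith
    refine ContinuousOn.if ?_ ?_ ?_
    · rintro w ⟨hw1, hw2⟩
      have hw : 1 / 2 = ‖w‖ := frontier_le_subset_eq continuous_const continuous_norm hw2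
      have h3 : ‖w‖⁻¹ • w = (2 : ℝ) • w := by rw [← hw]; norm_num
      have h4 : (2 : ℝ) * (1 - ‖w‖) = 1 := by rw [← hw]; norm_num
      rw [h3, h4]
      refine hKF _ ?_
      rw [mem_sphere_zero_iff_norm, norm_smul, ← hw]
      norm_num
    · refine h1.mono (inter_subset_inter_right _ ?_)
      exact closure_minimal subset_rfl (isClosed_le continuous_const continuous_norm)
    · refine h2.mono (inter_subset_inter_right _ ?_)
      refine closure_minimal (fun w hw => ?_) (isClosed_le continuous_norm continuous_const)
      exact (not_le.1 hw).le
  · intro w hw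
    rw [mem_sphere_zero_iff_norm] at hw
    simp only [hw]
    norm_num

/-- Extend `f` radially to `f'` off the origin and deform the sphere by `θ`, which sends the lower
half to one point and wraps the top face around the origin. Then `f' ∘ θ` is governed by a map of
the ball of `V` that is constant on its boundary; this is null-homotopic, hence `f' ∘ θ` extends,
and so does `f`. -/
theorem exists_extend_sphere_of_subsingleton_homotopyGroup {N : ℕ} {V : Type v}
    [NormedAddCommGroup V] [NormedSpace ℝ V] (e : V ≃ᵢ (Fin N → ℝ)) (he : e 0 = 0)
    (hY : ∀ y : Y, Subsingleton (HomotopyGroup.Pi N Y y)) {f : ℝ × V → Y}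
    (hf : ContinuousOn f (sphere 0 1)) :
    ∃ F : ℝ × V → Y, ContinuousOn F (closedBall 0 1) ∧ ∀ w ∈ sphere (0 : ℝ × V) 1, F w = f w := by
  classical
  let f' : ℝ × V → Y := fun w => f (‖w‖⁻¹ • w)
  have hf' : ContinuousOn f' {0}ᶜ := by
    refine hf.comp (ContinuousOn.smul (f := fun w : ℝ × V => ‖w‖⁻¹)
      (ContinuousOn.inv₀ (by fun_prop) ?_) continuousOn_id) ?_
    · intro w hw
      exact norm_ne_zero_iff.2 hw
    · intro w hw
      rw [mem_sphere_zero_iff_norm, norm_smul, norm_inv, norm_norm]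
      exact inv_mul_cancel₀ (norm_ne_zero_iff.2 hw)
  have hff' : ∀ w ∈ sphere (0 : ℝ × V) 1, f' w = f w := by
    intro w hw
    rw [mem_sphere_zero_iff_norm] at hw
    simp [f', hw]
  -- This wraps the unit ball of `V` around the origin, collapsing its boundary to (-1, 0).
  let c : V → ℝ × V := fun z => (1 - 2 * ‖z‖, (1 - ‖z‖) • z)
  have hc : Continuous c := by fun_prop
  have hc0 : ∀ z, c z ≠ 0 := by
    intro z hz
    have h1 : 1 - 2 * ‖z‖ = 0 := congrArg Prod.fst hz
    have h2 : (1 - ‖z‖) • z = 0 := congrArg Prod.snd hz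
    rcases smul_eq_zero.1 h2 with h | h
    · linarith
    · rw [h, norm_zero] at h1
      norm_num at h1
  have hc1 : ∀ z ∈ sphere (0 : V) 1, c z = (-1, 0) := by
    intro z hz
    rw [mem_sphere_zero_iff_norm] at hz
    refine Prod.ext ?_ ?_ <;> simp [c, hz]
    norm_num
  -- On the unit sphere `r` is `‖w.2‖` where `w.1 ≥ 0` and 1 elsewhere, so `θ w` is `c w.2` on the
  -- upper half and (-1, 0) below.
  let r : ℝ × V → ℝ := fun w => max ‖w.2‖ (min 1 (1 - w.1))
  have hr : Continuous r := by fun_prop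
  let θ : ℝ × V → ℝ × V := fun w => (1 - 2 * r w, (1 - r w) • w.2)
  have hθ : Continuous θ := by fun_prop
  have hS : ∀ w ∈ sphere (0 : ℝ × V) 1, |w.1| ≤ 1 ∧ ‖w.2‖ ≤ 1 ∧ (|w.1| = 1 ∨ ‖w.2‖ = 1) := by
    intro w hw
    rw [mem_sphere_zero_iff_norm, Prod.norm_def] at hw
    refine ⟨hw ▸ le_max_left _ _, hw ▸ le_max_right _ _, ?_⟩
    rcases max_choice ‖w.1‖ ‖w.2‖ with h | h
    · exact Or.inl (h.symm.trans hw)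
    · exact Or.inr (h.symm.trans hw)
  have hrle : ∀ w ∈ sphere (0 : ℝ × V) 1, r w ≤ 1 := fun w hw =>
    max_le (hS w hw).2.1 (min_le_left _ _)
  obtain ⟨H, hH, hH0, hH1, hHb⟩ := exists_nullhomotopy_of_subsingleton_homotopyGroup e he
    (hY (f' (-1, 0))) (g := fun z => f' (c z))
    (hf'.comp hc.continuousOn fun z _ => hc0 z) fun z hz => congrArg f' (hc1 z hz)
  have hstep : ∃ F1 : ℝ × V → Y, ContinuousOn F1 (closedBall 0 1) ∧
      ∀ w ∈ sphere (0 : ℝ × V) 1, F1 w = f' (θ w) := by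
    let K : ℝ × (ℝ × V) → Y := fun p => if 0 ≤ p.2.1 then H (p.1, p.2.2) else f' (-1, 0)
    have hK : ContinuousOn K (Icc 0 1 ×ˢ sphere 0 1) := by
      refine ContinuousOn.if ?_ ?_ continuousOn_const
      · rintro ⟨t, w⟩ ⟨⟨-, hw⟩, hw2⟩
        have h0 : 0 = w.1 := frontier_le_subset_eq (f := fun _ => 0)
          (g := fun p : ℝ × ℝ × V => p.2.1) continuous_const (by fun_prop) hw2
        refine hHb _ _ ?_
        rw [mem_sphere_zero_iff_norm]
        refine (hS w hw).2.2.resolve_left ?_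
        rw [← h0]
        norm_num
      · exact (hH.comp (by fun_prop)).continuousOn
    obtain ⟨F1, hF1, hF1s⟩ := exists_extend_closedBall_of_homotopy hK
      (F := fun _ => f' (-1, 0)) continuousOn_const (by
        intro w _
        simp only [K, hH1, ite_self])
    refine ⟨F1, hF1, fun w hw => ?_⟩
    rw [hF1s w hw]
    obtain ⟨hw1, hw2, hw3⟩ := hS w hw
    by_cases h : 0 ≤ w.1
    · have hr1 : r w = ‖w.2‖ := by
        refine max_eq_left ?_
        rcases hw3 with h3 | h3
        · rw [abs_of_nonneg h] at h3
          rw [h3]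
          simp
        · rw [h3]
          exact min_le_left _ _
      simp only [K, if_pos h]
      rw [hH0 _ (mem_closedBall_zero_iff.2 hw2)]
      simp only [c, θ, hr1]
    · have hr1 : r w = 1 := by
        rw [not_le] at h
        have : min 1 (1 - w.1) = 1 := min_eq_left (by linarith)
        simp only [r, this]
        exact max_eq_right hw2
      simp only [K, if_neg h, θ, hr1]
      norm_num
  obtain ⟨F1, hF1, hF1s⟩ := hstep
  -- The straight-line homotopy from the identity to `θ` misses the origin, so `f'` can be applied
  -- to it.
  have hne : ∀ t ∈ Icc (0 : ℝ) 1, ∀ w ∈ sphere (0 : ℝ × V) 1, (1 - t) • w + t • θ w ≠ 0 := by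
    intro t ht w hw hz
    obtain ⟨hw1, hw2, hw3⟩ := hS w hw
    have h1 : (1 - t) * w.1 + t * (1 - 2 * r w) = 0 := congrArg Prod.fst hz
    have h2 : (1 - t) • w.2 + t • ((1 - r w) • w.2) = 0 := congrArg Prod.snd hz
    have h3 : (1 - t * r w) • w.2 = 0 := by
      rw [← h2]
      module
    rcases smul_eq_zero.1 h3 with h | h
    · have hr1 := hrle w hw
      have ht1 : t = 1 := by nlinarith [ht.1, ht.2]
      subst ht1
      linarith
    · rw [h, norm_zero] at hw3
      have hr0 : r w = min 1 (1 - w.1) := by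
        simp only [r, h, norm_zero]
        exact max_eq_right (le_min zero_le_one (by linarith [(abs_le.1 hw1).2]))
      rcases eq_or_eq_neg_of_abs_eq (hw3.resolve_right (by norm_num)) with h4 | h4
      · rw [hr0, h4] at h1
        norm_num at h1
      · rw [hr0, h4] at h1
        norm_num at h1
        linarith
  obtain ⟨G, hG, hGs⟩ := exists_extend_closedBall_of_homotopy
    (K := fun p => f' ((1 - p.1) • p.2 + p.1 • θ p.2))
    (hf'.comp (by fun_prop : Continuous fun p : ℝ × (ℝ × V) =>
      (1 - p.1) • p.2 + p.1 • θ p.2).continuousOn fun p hp => hne p.1 hp.1 p.2 hp.2) hF1 (by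
      intro w hw
      simp [hF1s w hw])
  refine ⟨G, hG, fun w hw => ?_⟩
  rw [hGs w hw]
  simpa using hff' w hw

end SphereFilling

/-! ### Equivariant extension over freely permuted cells. -/

open Metric Set in
/-- A decomposition of a space with a group action into freely permuted open cells, such that the
boundary of every cell lies in a finite union of closed cells of lower dimension. The closed cells
carry the quotient topology of balls, but the space need not have the weak topology. -/
structure EquivariantCells (Γ : Type*) (Y : Type*) [Group Γ] [MulAction Γ Y] [TopologicalSpace Y]
    {A : Type*} (V : A → Type*) [∀ a, NormedAddCommGroup (V a)] where
  /-- The dimension of a cell. -/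
  dim : A → ℕ
  /-- The characteristic map of a cell. -/
  map : ∀ a, V a → Y
  continuousOn : ∀ a, ContinuousOn (map a) (closedBall 0 1)
  exists_eq : ∀ y, ∃ (g : Γ) (a : A) (z : V a), z ∈ closedBall 0 1 ∧ y = g • map a z
  unique : ∀ {g g' : Γ} {a a' : A} {z : V a} {z' : V a'}, z ∈ ball 0 1 → z' ∈ ball 0 1 →
    g • map a z = g' • map a' z' →
    (⟨g, a, z⟩ : Γ × (Σ a, V a)) = ⟨g', a', z'⟩
  boundary : ∀ a, ∃ F : Set (Γ × A), F.Finite ∧ (∀ b ∈ F, dim b.2 < dim a) ∧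
    ∀ z ∈ sphere (0 : V a) 1, ∃ b ∈ F, ∃ w ∈ closedBall (0 : V b.2) 1, map a z = b.1 • map b.2 w

namespace EquivariantCells

open Metric Set

variable {Γ : Type*} {Y : Type*} [Group Γ] [MulAction Γ Y] [TopologicalSpace Y]
  {A : Type*} {V : A → Type*} [∀ a, NormedAddCommGroup (V a)]
  (𝒞 : EquivariantCells Γ Y V)

/-- Descend through boundaries until an open cell is reached. When the descent stops at once,
uniqueness identifies the cell found, which gives the strict drop in dimension. -/
theorem exists_open_of_mem_closedBall (a : A) (z : V a) (hz : z ∈ closedBall 0 1) :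
    ∃ (g : Γ) (b : A) (w : V b), w ∈ ball 0 1 ∧ 𝒞.map a z = g • 𝒞.map b w ∧
      (z ∈ sphere 0 1 → 𝒞.dim b < 𝒞.dim a) := by
  induction h : 𝒞.dim a using Nat.strong_induction_on generalizing a with
  | _ n ih =>
    subst h
    by_cases hz1 : z ∈ ball 0 1
    · refine ⟨1, a, z, hz1, (one_smul _ _).symm, fun h => ?_⟩
      exact absurd (mem_sphere.1 h) (ne_of_lt (mem_ball.1 hz1))
    · have hz2 : z ∈ sphere 0 1 :=
        le_antisymm (mem_closedBall.1 hz) (not_lt.1 fun h => hz1 (mem_ball.2 h))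
      obtain ⟨F, -, hFd, hF⟩ := 𝒞.boundary a
      obtain ⟨b, hb, w, hw, e⟩ := hF z hz2
      obtain ⟨g, c, x, hx, e', hd⟩ := ih _ (hFd b hb) b.2 w hw rfl
      refine ⟨b.1 * g, c, x, hx, by rw [e, e', mul_smul], fun _ => ?_⟩
      by_cases hw1 : w ∈ ball 0 1
      · have h1 : (⟨1, b.2, w⟩ : Γ × (Σ a, V a)) = ⟨g, c, x⟩ :=
          𝒞.unique hw1 hx (by rw [one_smul, e'])
        have h2 : b.2 = c := congrArg (fun p : Γ × (Σ a, V a) => p.2.1) h1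
        exact h2 ▸ hFd b hb
      · exact (hd (le_antisymm (mem_closedBall.1 hw)
          (not_lt.1 fun h => hw1 (mem_ball.2 h)))).trans (hFd b hb)

theorem exists_open (y : Y) :
    ∃ p : Γ × (Σ a, V a), p.2.2 ∈ ball 0 1 ∧ y = p.1 • 𝒞.map p.2.1 p.2.2 := by
  obtain ⟨g, a, z, hz, rfl⟩ := 𝒞.exists_eq y
  obtain ⟨h, b, w, hw, e, -⟩ := 𝒞.exists_open_of_mem_closedBall a z hz
  exact ⟨⟨g * h, b, w⟩, hw, by rw [e, mul_smul]⟩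

/-- The open cell which contains a point, and its coordinate there. -/
noncomputable def loc (y : Y) : Γ × (Σ a, V a) := (𝒞.exists_open y).choose

theorem loc_mem (y : Y) : (𝒞.loc y).2.2 ∈ ball 0 1 := (𝒞.exists_open y).choose_spec.1

theorem loc_eq (y : Y) : y = (𝒞.loc y).1 • 𝒞.map (𝒞.loc y).2.1 (𝒞.loc y).2.2 :=
  (𝒞.exists_open y).choose_spec.2

theorem loc_smul_map (g : Γ) {a : A} {z : V a} (hz : z ∈ ball 0 1) :
    𝒞.loc (g • 𝒞.map a z) = ⟨g, a, z⟩ :=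
  𝒞.unique (𝒞.loc_mem _) hz (𝒞.loc_eq _).symm

theorem loc_smul (g : Γ) (y : Y) : 𝒞.loc (g • y) = ⟨g * (𝒞.loc y).1, (𝒞.loc y).2⟩ := by
  conv_lhs => rw [𝒞.loc_eq y, ← mul_smul]
  exact 𝒞.loc_smul_map _ (𝒞.loc_mem y)

theorem dim_loc_lt {a : A} {z : V a} (hz : z ∈ sphere 0 1) :
    𝒞.dim (𝒞.loc (𝒞.map a z)).2.1 < 𝒞.dim a := by
  obtain ⟨g, b, w, hw, e, hd⟩ := 𝒞.exists_open_of_mem_closedBall a z (sphere_subset_closedBall hz)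
  rw [e, 𝒞.loc_smul_map g hw]
  exact hd hz

section Section

variable {E : Type*} [MulAction Γ E]

/-- The function on the cell `a` obtained by extending successively over the cells by `ext`. -/
noncomputable def cellSection (ext : ∀ a, (V a → E) → V a → E) (e₀ : E) (a : A) : V a → E :=
  ext a fun z =>
    -- The guard is there for termination; by `dim_loc_lt` the default `e₀` is never used on the
    -- sphere.
    if _h : 𝒞.dim (𝒞.loc (𝒞.map a z)).2.1 < 𝒞.dim a then
      (𝒞.loc (𝒞.map a z)).1 •
        cellSection ext e₀ (𝒞.loc (𝒞.map a z)).2.1 (𝒞.loc (𝒞.map a z)).2.2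
    else e₀
termination_by 𝒞.dim a

/-- The function on the space assembled from the functions `cellSection` on the cells. -/
noncomputable def assemble (ext : ∀ a, (V a → E) → V a → E) (e₀ : E) (y : Y) : E :=
  (𝒞.loc y).1 • 𝒞.cellSection ext e₀ (𝒞.loc y).2.1 (𝒞.loc y).2.2

theorem assemble_smul (ext : ∀ a, (V a → E) → V a → E) (e₀ : E) (g : Γ) (y : Y) :
    𝒞.assemble ext e₀ (g • y) = g • 𝒞.assemble ext e₀ y := by
  rw [assemble, assemble, loc_smul, mul_smul]

theorem cellSection_eq (ext : ∀ a, (V a → E) → V a → E) (e₀ : E) (a : A) :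
    ∃ φ : V a → E, 𝒞.cellSection ext e₀ a = ext a φ ∧
      ∀ z ∈ sphere (0 : V a) 1, φ z = 𝒞.assemble ext e₀ (𝒞.map a z) := by
  refine ⟨_, by rw [cellSection], fun z hz => ?_⟩
  simp only [dif_pos (𝒞.dim_loc_lt hz)]
  rfl

variable [TopologicalSpace E]

/-- A continuous map from a compact set to a Hausdorff space is closed onto its image, so continuity
can be tested after composing with it. -/
theorem continuousOn_of_isCompact_of_comp {T Z W : Type*} [TopologicalSpace T]
    [TopologicalSpace Z] [TopologicalSpace W] [T2Space Z] {m : T → Z} {s : Z → W} {K : Set T}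
    (hK : IsCompact K) (hm : ContinuousOn m K) (hs : ContinuousOn (s ∘ m) K) :
    ContinuousOn s (m '' K) := by
  rw [continuousOn_iff_isClosed]
  intro C hC
  obtain ⟨D, hD, e⟩ := continuousOn_iff_isClosed.1 hs C hC
  refine ⟨m '' (D ∩ K), ((hK.inter_left hD).image_of_continuousOn
    (hm.mono inter_subset_right)).isClosed, ?_⟩
  ext y
  constructor
  · rintro ⟨hy, z, hz, rfl⟩
    exact ⟨⟨z, e ▸ ⟨hy, hz⟩, rfl⟩, z, hz, rfl⟩
  · rintro ⟨⟨z, hz, rfl⟩, hz'⟩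
    exact ⟨(e.symm ▸ hz : z ∈ s ∘ m ⁻¹' C ∩ K).1, hz'⟩

theorem continuousOn_biUnion_of_finite {ι Z W : Type*} [TopologicalSpace Z] [TopologicalSpace W]
    {s : Z → W} {F : Set ι} (hF : F.Finite) {C : ι → Set Z} (hC : ∀ i ∈ F, IsClosed (C i))
    (hs : ∀ i ∈ F, ContinuousOn s (C i)) : ContinuousOn s (⋃ i ∈ F, C i) := by
  rw [biUnion_eq_iUnion]
  have := hF.to_subtype
  exact (locallyFinite_of_finite _).continuousOn_iUnion (fun i => hC i i.2) fun i => hs i i.2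

/-- An equivariant map which is continuous on finitely many closed cells is continuous on their
union. -/
theorem continuousOn_iUnion_of_finite [T2Space Y] [∀ a, ProperSpace (V a)]
    [ContinuousConstSMul Γ Y] [ContinuousConstSMul Γ E] {s : Y → E}
    (hs : ∀ (g : Γ) y, s (g • y) = g • s y) {F : Set (Γ × A)} (hF : F.Finite)
    (h : ∀ b ∈ F, ContinuousOn (s ∘ 𝒞.map b.2) (closedBall 0 1)) :
    ContinuousOn s (⋃ b ∈ F, (fun z => b.1 • 𝒞.map b.2 z) '' closedBall 0 1) := by
  have hm : ∀ b : Γ × A, ContinuousOn (fun z => b.1 • 𝒞.map b.2 z) (closedBall 0 1) :=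
    fun b => (𝒞.continuousOn b.2).const_smul b.1
  refine continuousOn_biUnion_of_finite hF (fun b _ =>
    ((isCompact_closedBall _ _).image_of_continuousOn (hm b)).isClosed) fun b hb => ?_
  refine continuousOn_of_isCompact_of_comp (isCompact_closedBall _ _) (hm b) ?_
  have : (s ∘ fun z => b.1 • 𝒞.map b.2 z) = fun z => b.1 • (s ∘ 𝒞.map b.2) z :=
    funext fun z => hs _ _
  rw [this]
  exact (h b hb).const_smul b.1

/-- Induction on dimension: choose an extension over one cell in each orbit and let equivariance
dictate the others, which is consistent because the open cells are permuted freely. Without the weak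
topology only continuity on closed cells results. `Q` carries along properties of the chosen
extensions. -/
theorem exists_equivariant_section [T2Space Y] [∀ a, ProperSpace (V a)]
    [ContinuousConstSMul Γ Y] [ContinuousConstSMul Γ E] [Nonempty E] {p : E → Y}
    (hp : ∀ (g : Γ) e, p (g • e) = g • p e) (Q : ∀ a, (V a → E) → Prop)
    (hext : ∀ (a : A) (φ : V a → E), ContinuousOn φ (sphere 0 1) →
      (∀ z ∈ sphere (0 : V a) 1, p (φ z) = 𝒞.map a z) →
      ∃ ψ : V a → E, ContinuousOn ψ (closedBall 0 1) ∧
        (∀ z ∈ closedBall (0 : V a) 1, p (ψ z) = 𝒞.map a z) ∧ EqOn ψ φ (sphere 0 1) ∧ Q a ψ) :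
    ∃ s : Y → E, (∀ y, p (s y) = y) ∧ (∀ (g : Γ) y, s (g • y) = g • s y) ∧
      ∀ a, ContinuousOn (s ∘ 𝒞.map a) (closedBall 0 1) ∧
        ∃ ψ : V a → E, EqOn (s ∘ 𝒞.map a) ψ (closedBall 0 1) ∧ Q a ψ := by
  choose! ext hext1 hext2 hext3 hext4 using hext
  let e₀ : E := Classical.arbitrary E
  let S := 𝒞.cellSection ext e₀
  let s := 𝒞.assemble ext e₀
  have hs : ∀ (g : Γ) y, s (g • y) = g • s y := 𝒞.assemble_smul ext e₀
  have main : ∀ n a, 𝒞.dim a = n → ContinuousOn (S a) (closedBall 0 1) ∧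
      (∀ z ∈ closedBall (0 : V a) 1, p (S a z) = 𝒞.map a z) ∧
      EqOn (s ∘ 𝒞.map a) (S a) (closedBall 0 1) ∧ Q a (S a) := by
    intro n
    induction n using Nat.strong_induction_on with
    | _ n ih =>
      rintro a rfl
      obtain ⟨φ, hφ, hφs⟩ := 𝒞.cellSection_eq ext e₀ a
      -- The sphere lands in a finite union of translated closed cells of lower dimension, on which
      -- `s` is already continuous.
      have hφc : ContinuousOn φ (sphere 0 1) := by
        obtain ⟨F, hF, hFd, hFb⟩ := 𝒞.boundary a
        have h1 := 𝒞.continuousOn_iUnion_of_finite hs hF fun b hb =>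
          (ih _ (hFd b hb) b.2 rfl).1.congr (ih _ (hFd b hb) b.2 rfl).2.2.1
        refine (h1.comp ((𝒞.continuousOn a).mono sphere_subset_closedBall) fun z hz => ?_).congr
          hφs
        obtain ⟨b, hb, w, hw, e⟩ := hFb z hz
        exact mem_biUnion hb ⟨w, hw, e.symm⟩
      have hφp : ∀ z ∈ sphere (0 : V a) 1, p (φ z) = 𝒞.map a z := by
        intro z hz
        rw [hφs z hz]
        conv_rhs => rw [𝒞.loc_eq (𝒞.map a z)]
        rw [assemble, hp, (ih _ (𝒞.dim_loc_lt hz) _ rfl).2.1 _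
          (ball_subset_closedBall (𝒞.loc_mem _))]
      have hS : S a = ext a φ := hφ
      rw [hS]
      refine ⟨hext1 a φ hφc hφp, hext2 a φ hφc hφp, fun z hz => ?_, hext4 a φ hφc hφp⟩
      by_cases hz1 : z ∈ ball 0 1
      · have h1 : 𝒞.loc (𝒞.map a z) = ⟨1, a, z⟩ := by
          conv_lhs => rw [← one_smul Γ (𝒞.map a z)]
          exact 𝒞.loc_smul_map 1 hz1
        rw [← hS]
        change 𝒞.assemble ext e₀ (𝒞.map a z) = _
        rw [assemble, h1]
        exact one_smul _ _
      · have hz2 : z ∈ sphere 0 1 :=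
          le_antisymm (mem_closedBall.1 hz) (not_lt.1 fun h => hz1 (mem_ball.2 h))
        rw [hext3 a φ hφc hφp hz2, hφs z hz2]
        rfl
  refine ⟨s, fun y => ?_, hs, fun a => ?_⟩
  · conv_rhs => rw [𝒞.loc_eq y]
    change p (𝒞.assemble ext e₀ y) = _
    rw [assemble, hp, (main _ _ rfl).2.1 _ (ball_subset_closedBall (𝒞.loc_mem _))]
  · obtain ⟨h1, -, h3, h4⟩ := main _ a rfl
    exact ⟨h1.congr h3, S a, h3, h4⟩

end Section

end EquivariantCells

/-! ### CW complexes: characteristic maps and cellwise sections. -/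

namespace Topology.CWComplex

open Metric Set

/-- The cells of all dimensions of a space with a CW structure. -/
abbrev Cells (X : Type u) [TopologicalSpace X] [CWComplex (univ : Set X)] : Type u :=
  Σ n, RelCWComplex.cell (univ : Set X) n

variable {X : Type u} [TopologicalSpace X] [CWComplex (univ : Set X)]

/-- The characteristic map of a cell. -/
def charMap (a : Cells X) : (Fin a.1 → ℝ) → X := RelCWComplex.map a.1 a.2

theorem continuousOn_charMap (a : Cells X) : ContinuousOn (charMap a) (closedBall 0 1) :=
  RelCWComplex.continuousOn a.1 a.2

theorem exists_eq_charMap (x : X) :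
    ∃ (a : Cells X) (z : Fin a.1 → ℝ), z ∈ closedBall 0 1 ∧ x = charMap a z := by
  have h : x ∈ ⋃ (n : ℕ) (j : RelCWComplex.cell (univ : Set X) n),
      RelCWComplex.closedCell n j := by
    rw [CWComplex.union]
    trivial
  simp only [mem_iUnion] at h
  obtain ⟨n, j, z, hz, rfl⟩ := h
  exact ⟨⟨n, j⟩, z, hz, rfl⟩

theorem charMap_injective {a b : Cells X} {z : Fin a.1 → ℝ} {w : Fin b.1 → ℝ}
    (hz : z ∈ ball 0 1) (hw : w ∈ ball 0 1) (h : charMap a z = charMap b w) :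
    (⟨a, z⟩ : Σ a : Cells X, Fin a.1 → ℝ) = ⟨b, w⟩ := by
  have hab : a = b := by
    by_contra hne
    exact disjoint_left.1 (RelCWComplex.disjoint_openCell_of_ne (C := (univ : Set X)) hne)
      ⟨z, hz, rfl⟩ ⟨w, hw, h.symm⟩
  subst hab
  have hs := RelCWComplex.source_eq (C := (univ : Set X)) a.1 a.2
  have : z = w := (RelCWComplex.map (C := (univ : Set X)) a.1 a.2).injOn (hs ▸ hz) (hs ▸ hw) h
  rw [this]

theorem exists_finite_boundary (a : Cells X) : ∃ F : Set (Cells X), F.Finite ∧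
    (∀ b ∈ F, b.1 < a.1) ∧ ∀ z ∈ sphere (0 : Fin a.1 → ℝ) 1, ∃ b ∈ F,
      ∃ w ∈ closedBall (0 : Fin b.1 → ℝ) 1, charMap a z = charMap b w := by
  obtain ⟨J, hJ⟩ := CWComplex.mapsTo (C := (univ : Set X)) a.1 a.2
  refine ⟨(((Finset.range a.1).sigma J : Finset (Cells X)) : Set (Cells X)),
    Finset.finite_toSet _, fun b hb => ?_, fun z hz => ?_⟩
  · simpa using (Finset.mem_sigma.1 (Finset.mem_coe.1 hb)).1
  · have h := hJ hz
    simp only [mem_iUnion] at h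
    obtain ⟨m, hm, j, hj, w, hw, e⟩ := h
    exact ⟨⟨m, j⟩, by simpa using ⟨hm, hj⟩, w, hw, e.symm⟩

theorem continuous_of_comp_charMap [T2Space X] {E : Type*} [TopologicalSpace E] {s : X → E}
    (hs : ∀ a : Cells X, ContinuousOn (s ∘ charMap a) (closedBall 0 1)) : Continuous s := by
  refine continuous_iff_isClosed.2 fun C hC => ?_
  refine (CWComplex.closed (univ : Set X) _ (subset_univ _)).2 fun n j => ?_
  have h := EquivariantCells.continuousOn_of_isCompact_of_comp (isCompact_closedBall _ _)
    (continuousOn_charMap ⟨n, j⟩) (hs ⟨n, j⟩)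
  obtain ⟨D, hD, e⟩ := continuousOn_iff_isClosed.1 h C hC
  have e' : s ⁻¹' C ∩ RelCWComplex.closedCell n j = D ∩ RelCWComplex.closedCell n j := e
  rw [e']
  exact hD.inter RelCWComplex.isClosed_closedCell

/-- The complex is a quotient of a disjoint union of closed balls, and local path-connectedness
passes to quotients. -/
theorem locallyPathConnectedSpace [T2Space X] : LocallyPathConnectedSpace X := by
  have : ∀ a : Cells X, LocallyPathConnectedSpace (closedBall (0 : Fin a.1 → ℝ) 1) :=
    fun a => (convex_closedBall _ _).locallyPathConnectedSpace
  let f : (Σ a : Cells X, closedBall (0 : Fin a.1 → ℝ) 1) → X := fun p => charMap p.1 p.2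
  have hfa : ∀ a : Cells X, Continuous fun z : closedBall (0 : Fin a.1 → ℝ) 1 => charMap a z :=
    fun a => continuousOn_iff_continuous_domRestrict.1 (continuousOn_charMap a)
  have hf : Continuous f := continuous_sigma hfa
  have hq : IsQuotientMap f := by
    refine isQuotientMap_iff_isClosed.2 ⟨fun x => ?_, fun S =>
      ⟨fun h => h.preimage hf, fun h => ?_⟩⟩
    · obtain ⟨a, z, hz, rfl⟩ := exists_eq_charMap x
      exact ⟨⟨a, z, hz⟩, rfl⟩
    · refine (CWComplex.closed (univ : Set X) _ (subset_univ _)).2 fun n j => ?_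
      have h1 : IsClosed ((fun z : closedBall (0 : Fin n → ℝ) 1 => charMap ⟨n, j⟩ z) ⁻¹' S) :=
        isClosed_sigma_iff.1 h ⟨n, j⟩
      have : CompactSpace (closedBall (0 : Fin n → ℝ) 1) :=
        isCompact_iff_compactSpace.1 (isCompact_closedBall _ _)
      convert (h1.isCompact.image (hfa ⟨n, j⟩)).isClosed using 1
      ext x
      constructor
      · rintro ⟨hx, z, hz, rfl⟩
        exact ⟨⟨z, hz⟩, hx, rfl⟩
      · rintro ⟨z, hz, rfl⟩
        exact ⟨hz, z, z.2, rfl⟩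
  exact hq.locallyPathConnectedSpace

/-- The equivariant construction for the trivial group; here the weak topology turns cellwise
continuity into continuity. -/
theorem exists_section [T2Space X] {E : Type*} [TopologicalSpace E] [Nonempty E] {p : E → X}
    (Q : ∀ a : Cells X, ((Fin a.1 → ℝ) → E) → Prop)
    (hext : ∀ (a : Cells X) (φ : (Fin a.1 → ℝ) → E), ContinuousOn φ (sphere 0 1) →
      (∀ z ∈ sphere (0 : Fin a.1 → ℝ) 1, p (φ z) = charMap a z) →
      ∃ ψ : (Fin a.1 → ℝ) → E, ContinuousOn ψ (closedBall 0 1) ∧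
        (∀ z ∈ closedBall (0 : Fin a.1 → ℝ) 1, p (ψ z) = charMap a z) ∧
        EqOn ψ φ (sphere 0 1) ∧ Q a ψ) :
    ∃ s : X → E, Continuous s ∧ (∀ x, p (s x) = x) ∧
      ∀ a, ∃ ψ : (Fin a.1 → ℝ) → E, EqOn (s ∘ charMap a) ψ (closedBall 0 1) ∧ Q a ψ := by
  let : MulAction Unit X :=
    { smul := fun _ x => x, one_smul := fun _ => rfl, mul_smul := fun _ _ _ => rfl }
  let : MulAction Unit E :=
    { smul := fun _ z => z, one_smul := fun _ => rfl, mul_smul := fun _ _ _ => rfl }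
  have : ContinuousConstSMul Unit X := ⟨fun _ => continuous_id⟩
  have : ContinuousConstSMul Unit E := ⟨fun _ => continuous_id⟩
  let 𝒞 : EquivariantCells Unit X (fun a : Cells X => Fin a.1 → ℝ) :=
    { dim := fun a => a.1
      map := charMap
      continuousOn := continuousOn_charMap
      exists_eq := fun x => by
        obtain ⟨a, z, hz, e⟩ := exists_eq_charMap x
        exact ⟨1, a, z, hz, e⟩
      unique := fun {g g' a a' z z'} hz hz' h => by
        have := charMap_injective hz hz' h
        cases this
        rfl
      boundary := fun a => by
        obtain ⟨F, hF, hFd, hFb⟩ := exists_finite_boundary a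
        refine ⟨Prod.mk () '' F, hF.image _, ?_, fun z hz => ?_⟩
        · rintro _ ⟨b, hb, rfl⟩
          exact hFd b hb
        · obtain ⟨b, hb, w, hw, e⟩ := hFb z hz
          exact ⟨⟨(), b⟩, ⟨b, hb, rfl⟩, w, hw, e⟩ }
  obtain ⟨s, hs1, -, hs2⟩ := 𝒞.exists_equivariant_section (p := p) (fun _ _ => rfl) Q hext
  exact ⟨s, continuous_of_comp_charMap fun a => (hs2 a).1, hs1, fun a => (hs2 a).2⟩

end Topology.CWComplex

/-! ### Collars of cells and coordinates on open stars. -/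

namespace Topology.CWComplex

open Metric Set

variable {X : Type u} [TopologicalSpace X] [CWComplex (univ : Set X)]

theorem norm_inv_smul_mem_sphere {W : Type*} [NormedAddCommGroup W] [NormedSpace ℝ W] {z : W}
    (hz : z ≠ 0) : ‖z‖⁻¹ • z ∈ sphere (0 : W) 1 := by
  rw [mem_sphere_zero_iff_norm, norm_smul, norm_inv, norm_norm]
  exact inv_mul_cancel₀ (norm_ne_zero_iff.2 hz)

theorem continuousOn_norm_inv_smul {W : Type*} [NormedAddCommGroup W] [NormedSpace ℝ W] :
    ContinuousOn (fun z : W => ‖z‖⁻¹ • z) {0}ᶜ :=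
  ContinuousOn.smul (f := fun z : W => ‖z‖⁻¹)
    (ContinuousOn.inv₀ (by fun_prop) fun _ h => norm_ne_zero_iff.2 h) continuousOn_id

/-- A family of paths over the sphere that start at the values of a map on the ball extends over
the ball, in such a way that near the sphere the endpoints do not change in the radial direction. -/
theorem exists_extend_paths {Z : Type*} [TopologicalSpace Z] {W : Type*} [NormedAddCommGroup W]
    [NormedSpace ℝ W] {m : W → Z} (hm : ContinuousOn m (closedBall 0 1)) {φ : W → C(I, Z)}
    (hφ : ContinuousOn φ (sphere 0 1)) (hφ0 : ∀ z ∈ sphere (0 : W) 1, φ z 0 = m z) :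
    ∃ ψ : W → C(I, Z), Continuous ψ ∧ (∀ z ∈ closedBall (0 : W) 1, ψ z 0 = m z) ∧
      EqOn ψ φ (sphere 0 1) ∧
      (∀ z ∈ closedBall (0 : W) 1, 1 / 2 ≤ ‖z‖ → ψ z 1 = ψ (‖z‖⁻¹ • z) 1) ∧
      ∀ z t, ψ z t ∈ m '' closedBall 0 1 ∨ ∃ u ∈ sphere (0 : W) 1, ∃ t', ψ z t = ψ u t' := by
  classical
  -- On the ball of radius 2, `G` is `m` inside and follows the paths `φ` along rays outside.
  let G : W → Z := fun v =>
    if ‖v‖ ≤ 1 then m v else φ (‖v‖⁻¹ • v) (projIcc 0 1 zero_le_one (‖v‖ - 1))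
  have hG : Continuous G := by
    rw [← continuousOn_univ]
    refine ContinuousOn.if ?_ ?_ ?_
    · rintro v ⟨-, hv⟩
      have h1 : ‖v‖ = 1 := frontier_le_subset_eq continuous_norm continuous_const hv
      have h2 : projIcc (0 : ℝ) 1 zero_le_one (‖v‖ - 1) = 0 := by
        rw [h1, sub_self]
        exact projIcc_left _
      rw [h2, h1, inv_one, one_smul]
      exact (hφ0 v (mem_sphere_zero_iff_norm.2 h1)).symm
    · refine hm.mono fun v hv => mem_closedBall_zero_iff.2 ?_
      exact closure_minimal subset_rfl (isClosed_le continuous_norm continuous_const) hv.2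
    · have h1 : univ ∩ closure {v : W | ¬‖v‖ ≤ 1} ⊆ {0}ᶜ := by
        rintro v ⟨-, hv⟩ hv0
        have : 1 ≤ ‖v‖ := closure_minimal (fun w (hw : ¬‖w‖ ≤ 1) => (not_le.1 hw).le)
          (isClosed_le continuous_const continuous_norm) hv
        rw [mem_singleton_iff.1 hv0, norm_zero] at this
        norm_num at this
      have h2 : ContinuousOn (fun v : W => φ (‖v‖⁻¹ • v))
          (univ ∩ closure {v : W | ¬‖v‖ ≤ 1}) :=
        hφ.comp (continuousOn_norm_inv_smul.mono h1) fun v hv => norm_inv_smul_mem_sphere (h1 hv)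
      have h3 : Continuous fun v : W => projIcc (0 : ℝ) 1 zero_le_one (‖v‖ - 1) :=
        continuous_projIcc.comp (by fun_prop)
      exact h2.eval h3.continuousOn
  -- For ‖z‖ ≥ 1/2 this makes (1 + k z) • z the point of norm 2 on the ray of `z`, so the endpoint
  -- is radially constant there. The maximum keeps the denominator away from 0.
  let k : W → ℝ := fun z => (2 - max ‖z‖ (1 / 2)) / max ‖z‖ (1 / 2)
  have hk : Continuous k := by
    refine Continuous.div (by fun_prop) (by fun_prop) fun z => ?_
    exact ne_of_gt (lt_of_lt_of_le (by norm_num) (le_max_right _ _))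
  have hk1 : ∀ z, ‖z‖ = 1 → k z = 1 := by
    intro z hz
    simp only [k, hz]
    norm_num
  let Ψ : C(W × I, Z) := ⟨fun q => G ((1 + (q.2 : ℝ) * k q.1) • q.1), hG.comp (by fun_prop)⟩
  have hΨφ : ∀ z ∈ sphere (0 : W) 1, ∀ t, Ψ (z, t) = φ z t := by
    intro z hz t
    have hz1 := mem_sphere_zero_iff_norm.1 hz
    have h1 : ‖(1 + (t : ℝ)) • z‖ = 1 + t := by
      rw [norm_smul, hz1, mul_one, Real.norm_of_nonneg (by linarith [t.2.1])]
    change G ((1 + (t : ℝ) * k z) • z) = _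
    rw [hk1 z hz1, mul_one]
    by_cases ht : (t : ℝ) = 0
    · have ht' : t = 0 := Subtype.ext ht
      rw [ht, add_zero, one_smul, ht', hφ0 z hz]
      exact if_pos hz1.le
    · have ht' : 0 < (t : ℝ) := lt_of_le_of_ne t.2.1 (Ne.symm ht)
      simp only [G, h1]
      rw [if_neg (by linarith), smul_smul, inv_mul_cancel₀ (by linarith), one_smul,
        add_sub_cancel_left, projIcc_val]
  refine ⟨fun z => Ψ.curry z, Ψ.curry.continuous, fun z hz => ?_, fun z hz => ?_,
    fun z hz hz2 => ?_, fun z t => ?_⟩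
  · change G ((1 + ((0 : I) : ℝ) * k z) • z) = m z
    simp only [Icc.coe_zero, zero_mul, add_zero, one_smul]
    exact if_pos (mem_closedBall_zero_iff.1 hz)
  · ext t
    exact hΨφ z hz t
  · have hz0 : z ≠ 0 := by
      rintro rfl
      norm_num at hz2
    have hz1 := mem_sphere_zero_iff_norm.1 (norm_inv_smul_mem_sphere hz0)
    change G ((1 + ((1 : I) : ℝ) * k z) • z) =
      G ((1 + ((1 : I) : ℝ) * k (‖z‖⁻¹ • z)) • (‖z‖⁻¹ • z))
    rw [hk1 _ hz1, smul_smul]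
    congr 2
    have : ‖z‖ ≠ 0 := norm_ne_zero_iff.2 hz0
    simp only [k, max_eq_left hz2, Icc.coe_one]
    field_simp
    ring
  · change G ((1 + (t : ℝ) * k z) • z) ∈ _ ∨ ∃ u ∈ _, ∃ t', G ((1 + (t : ℝ) * k z) • z) = Ψ (u, t')
    set v := (1 + (t : ℝ) * k z) • z
    by_cases hv : ‖v‖ ≤ 1
    · exact Or.inl ⟨v, mem_closedBall_zero_iff.2 hv, (if_pos hv).symm⟩
    · have hv0 : v ≠ 0 := by
        intro h
        rw [h, norm_zero] at hv
        norm_num at hv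
      refine Or.inr ⟨_, norm_inv_smul_mem_sphere hv0, projIcc 0 1 zero_le_one (‖v‖ - 1), ?_⟩
      rw [hΨφ _ (norm_inv_smul_mem_sphere hv0)]
      exact if_neg hv

/-- A deformation of a CW complex that collapses collars of the boundaries of all cells. -/
theorem exists_collar_deformation [T2Space X] :
    ∃ h : X → C(I, X), Continuous h ∧ (∀ x, h x 0 = x) ∧
      (∀ (a : Cells X), ∀ z ∈ closedBall (0 : Fin a.1 → ℝ) 1, 1 / 2 ≤ ‖z‖ →
        h (charMap a z) 1 = h (charMap a (‖z‖⁻¹ • z)) 1) ∧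
      ∀ (a : Cells X), ∃ F : Set (Cells X), F.Finite ∧
        ∀ z ∈ closedBall (0 : Fin a.1 → ℝ) 1, ∀ t, ∃ b ∈ F,
          h (charMap a z) t ∈ charMap b '' closedBall 0 1 := by
  by_cases hX : Nonempty X
  · have : Nonempty C(I, X) := ⟨.const _ hX.some⟩
    obtain ⟨h, hh, hh0, hhQ⟩ := exists_section (X := X) (E := C(I, X)) (p := fun ω => ω 0)
      (fun a ψ => (∀ z ∈ closedBall (0 : Fin a.1 → ℝ) 1, 1 / 2 ≤ ‖z‖ →
          ψ z 1 = ψ (‖z‖⁻¹ • z) 1) ∧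
        ∀ z t, ψ z t ∈ charMap a '' closedBall 0 1 ∨
          ∃ u ∈ sphere (0 : Fin a.1 → ℝ) 1, ∃ t', ψ z t = ψ u t')
      (fun a φ hφ hφ0 => by
        obtain ⟨ψ, h1, h2, h3, h4, h5⟩ :=
          exists_extend_paths (continuousOn_charMap a) hφ hφ0
        exact ⟨ψ, h1.continuousOn, h2, h3, h4, h5⟩)
    refine ⟨h, hh, hh0, fun a z hz hz2 => ?_, fun a => ?_⟩
    · obtain ⟨ψ, hψ, hψ1, -⟩ := hhQ a
      have hz0 : z ≠ 0 := by
        rintro rfl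
        norm_num at hz2
      have h1 : h (charMap a z) = ψ z := hψ hz
      have h2 : h (charMap a (‖z‖⁻¹ • z)) = ψ (‖z‖⁻¹ • z) :=
        hψ (sphere_subset_closedBall (norm_inv_smul_mem_sphere hz0))
      rw [h1, h2, hψ1 z hz hz2]
    -- A path starting in a closed cell takes values in that cell or in paths starting on its
    -- boundary, so induction on dimension leaves finitely many cells.
    · suffices H : ∀ (n : ℕ) (a : Cells X), a.1 = n → ∃ F : Set (Cells X), F.Finite ∧
          ∀ z ∈ closedBall (0 : Fin a.1 → ℝ) 1, ∀ t, ∃ b ∈ F,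
            h (charMap a z) t ∈ charMap b '' closedBall 0 1 from H _ a rfl
      clear a
      intro n
      induction n using Nat.strong_induction_on with
      | _ n ih =>
        rintro a rfl
        obtain ⟨B, hB, hBd, hBb⟩ := exists_finite_boundary a
        choose! F hF hFm using fun b (hb : b ∈ B) => ih _ (hBd b hb) b rfl
        obtain ⟨ψ, hψ, -, hψ2⟩ := hhQ a
        refine ⟨insert a (⋃ b ∈ B, F b), (hB.biUnion hF).insert a, fun z hz t => ?_⟩
        have h1 : h (charMap a z) = ψ z := hψ hz
        rcases hψ2 z t with h2 | ⟨v, hv, t', h2⟩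
        · exact ⟨a, mem_insert _ _, h1 ▸ h2⟩
        · have h3 : h (charMap a v) = ψ v := hψ (sphere_subset_closedBall hv)
          obtain ⟨b, hb, w, hw, e⟩ := hBb v hv
          obtain ⟨c, hc, hc'⟩ := hFm b hb w hw t'
          refine ⟨c, mem_insert_of_mem _ (mem_biUnion hb hc), ?_⟩
          rw [h1, h2, ← h3, e]
          exact hc'
  · rw [not_nonempty_iff] at hX
    exact ⟨fun x => isEmptyElim x, continuous_of_const fun x => isEmptyElim x,
      fun x => isEmptyElim x, fun a => isEmptyElim (charMap a 0),
      fun a => isEmptyElim (charMap a 0)⟩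

/-- The weighted coordinate on the open star of a cell: `λ` is a weight that is positive on the
star, and `w / λ` is the retraction of the star to the open cell. -/
theorem exists_star_coordinate [T2Space X] (a : Cells X) :
    ∃ R : X → (Fin a.1 → ℝ) × ℝ, Continuous R ∧
      (∀ z ∈ closedBall (0 : Fin a.1 → ℝ) 1, R (charMap a z) =
        max 0 (2 * ‖z‖ - 1) • R (charMap a (‖z‖⁻¹ • z)) + (1 - ‖z‖) • (z, 1)) ∧
      ∀ b : Cells X, b ≠ a → ∀ z ∈ closedBall (0 : Fin b.1 → ℝ) 1, R (charMap b z) =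
        max 0 (2 * ‖z‖ - 1) • R (charMap b (‖z‖⁻¹ • z)) := by
  classical
  -- Only the cell `a` contributes a new term; every cell otherwise propagates its boundary values
  -- inwards, damped to zero at radius 1/2.
  have hbump : ∃ B : ∀ b : Cells X, (Fin b.1 → ℝ) → (Fin a.1 → ℝ) × ℝ,
      (∀ b, Continuous (B b)) ∧
      (∀ b : Cells X, ∀ z ∈ sphere (0 : Fin b.1 → ℝ) 1, B b z = 0) ∧
      (∀ z, B a z = (1 - ‖z‖) • (z, 1)) ∧ ∀ b, b ≠ a → ∀ z, B b z = 0 := by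
    refine ⟨fun b z => if h : b = a then (1 - ‖z‖) • (h ▸ z, 1) else 0, ?_, ?_, ?_, ?_⟩
    · intro b
      by_cases h : b = a
      · subst h
        simp only [dif_pos]
        fun_prop
      · simp only [dif_neg h]
        exact continuous_const
    · intro b z hz
      rw [mem_sphere_zero_iff_norm] at hz
      by_cases h : b = a
      · simp [hz]
      · simp [h]
    · intro z
      simp
    · intro b h z
      simp [h]
  obtain ⟨B, hB, hB0, hBa, hBb⟩ := hbump
  have hX : Nonempty X := ⟨charMap a 0⟩
  obtain ⟨s, hs, hs1, hsQ⟩ := exists_section (X := X) (E := X × ((Fin a.1 → ℝ) × ℝ))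
    (p := Prod.fst)
    (fun b ψ => ∀ z ∈ closedBall (0 : Fin b.1 → ℝ) 1,
      (ψ z).2 = max 0 (2 * ‖z‖ - 1) • (ψ (‖z‖⁻¹ • z)).2 + B b z)
    (fun b φ hφ hφp => by
      have hval : ∀ z ∈ sphere (0 : Fin b.1 → ℝ) 1,
          max 0 (2 * ‖z‖ - 1) • (φ (‖z‖⁻¹ • z)).2 + B b z = (φ z).2 := by
        intro z hz
        rw [hB0 b z hz, mem_sphere_zero_iff_norm.1 hz]
        norm_num
      refine ⟨fun z => (charMap b z, max 0 (2 * ‖z‖ - 1) • (φ (‖z‖⁻¹ • z)).2 + B b z),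
        (continuousOn_charMap b).prodMk (ContinuousOn.add ?_ (hB b).continuousOn),
        fun z _ => rfl, fun z hz => Prod.ext (hφp z hz).symm (hval z hz), fun z hz => ?_⟩
      · have hc1 : ContinuousOn (fun z : Fin b.1 → ℝ => (φ (‖z‖⁻¹ • z)).2)
            {0}ᶜ :=
          continuous_snd.comp_continuousOn
            (hφ.comp continuousOn_norm_inv_smul fun z hz => norm_inv_smul_mem_sphere hz)
        intro z hz
        -- The damping factor vanishes near the centre, where radial projection is discontinuous.
        by_cases hz0 : z = 0
        · have h0 : (fun _ => 0) =ᶠ[𝓝 z] fun z : Fin b.1 → ℝ =>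
              max 0 (2 * ‖z‖ - 1) • (φ (‖z‖⁻¹ • z)).2 := by
            have : ∀ᶠ y in 𝓝 z, ‖y‖ < 1 / 2 := by
              refine continuous_norm.continuousAt.eventually_lt continuousAt_const ?_
              rw [hz0, norm_zero]
              norm_num
            filter_upwards [this] with y hy
            rw [max_eq_left (by linarith), zero_smul]
          exact (continuousAt_const.congr h0).continuousWithinAt
        · have hmax : Continuous fun z : Fin b.1 → ℝ => max 0 (2 * ‖z‖ - 1) := by fun_prop
          exact (hmax.continuousAt.smul
            (hc1.continuousAt (isOpen_compl_singleton.mem_nhds hz0))).continuousWithinAt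
      · by_cases hz0 : z = 0
        · subst hz0
          simp
        · beta_reduce
          rw [hval _ (norm_inv_smul_mem_sphere hz0)])
  refine ⟨fun x => (s x).2, continuous_snd.comp hs, ?_, ?_⟩
  · intro z hz
    obtain ⟨ψ, hψ, hψQ⟩ := hsQ a
    have h1 : s (charMap a z) = ψ z := hψ hz
    have h2 : s (charMap a (‖z‖⁻¹ • z)) = ψ (‖z‖⁻¹ • z) := hψ (by
      by_cases hz0 : z = 0
      · simp [hz0]
      · exact sphere_subset_closedBall (norm_inv_smul_mem_sphere hz0))
    beta_reduce
    rw [h1, h2, hψQ z hz, hBa]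
  · intro b hb z hz
    obtain ⟨ψ, hψ, hψQ⟩ := hsQ b
    have h1 : s (charMap b z) = ψ z := hψ hz
    have h2 : s (charMap b (‖z‖⁻¹ • z)) = ψ (‖z‖⁻¹ • z) := hψ (by
      by_cases hz0 : z = 0
      · simp [hz0]
      · exact sphere_subset_closedBall (norm_inv_smul_mem_sphere hz0))
    beta_reduce
    rw [h1, h2, hψQ z hz, hBb b hb, add_zero]

end Topology.CWComplex

/-! ### A deformation that locally factors through a ball, and semilocal simple connectivity. -/

namespace Topology.CWComplex

open Metric Set

variable {X : Type u} [TopologicalSpace X] [CWComplex (univ : Set X)]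

/-- `V` is the open star of the open cell containing `x`, where the weight of
`exists_star_coordinate` is positive. Off the cell `a`, positive weight forces a point into the
collar; there neither `r` nor the end of `h` changes along the ray, so one may pass to the boundary
and induct on dimension. -/
theorem exists_deformation [T2Space X] :
    ∃ h : X → C(I, X), Continuous h ∧ (∀ x, h x 0 = x) ∧
      (∀ (a : Cells X), ∃ F : Set (Cells X), F.Finite ∧
        ∀ z ∈ closedBall (0 : Fin a.1 → ℝ) 1, ∃ b ∈ F,
          h (charMap a z) 1 ∈ charMap b '' closedBall 0 1) ∧
      ∀ x, ∃ (a : Cells X) (V : Set X) (r : X → Fin a.1 → ℝ), IsOpen V ∧ x ∈ V ∧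
        ContinuousOn r V ∧ (∀ y ∈ V, r y ∈ ball 0 1) ∧
        ∀ y ∈ V, h y 1 = h (charMap a (r y)) 1 := by
  obtain ⟨h, hh, hh0, hrad, hfin⟩ := exists_collar_deformation (X := X)
  refine ⟨h, hh, hh0, fun a => ?_, fun x => ?_⟩
  · obtain ⟨F, hF, hFm⟩ := hfin a
    exact ⟨F, hF, fun z hz => hFm z hz 1⟩
  obtain ⟨a, z₀, hz₀, hx⟩ : ∃ (a : Cells X) (z : Fin a.1 → ℝ), z ∈ ball 0 1 ∧
      x = charMap a z := by
    have h1 : x ∈ ⋃ (n : ℕ) (j : RelCWComplex.cell (univ : Set X) n),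
        RelCWComplex.openCell n j := by
      rw [CWComplex.iUnion_openCell_eq_complex]
      trivial
    simp only [mem_iUnion] at h1
    obtain ⟨n, j, z, hz, rfl⟩ := h1
    exact ⟨⟨n, j⟩, z, hz, rfl⟩
  obtain ⟨R, hR, hRa, hRb⟩ := exists_star_coordinate a
  -- No other cell of dimension at most that of `a` meets the star, so on the closed cell `a` only
  -- the new term survives.
  have hlow : ∀ (n : ℕ) (b : Cells X), b.1 = n → b ≠ a → b.1 ≤ a.1 →
      ∀ z ∈ closedBall (0 : Fin b.1 → ℝ) 1, R (charMap b z) = 0 := by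
    intro n
    induction n using Nat.strong_induction_on with
    | _ n ih =>
      rintro b rfl hb hba z hz
      rw [hRb b hb z hz]
      by_cases hz1 : ‖z‖ ≤ 1 / 2
      · rw [max_eq_left (by linarith), zero_smul]
      · have hz0 : z ≠ 0 := by
          rintro rfl
          norm_num at hz1
        obtain ⟨B, -, hBd, hBb⟩ := exists_finite_boundary b
        obtain ⟨c, hc, w, hw, e⟩ := hBb _ (norm_inv_smul_mem_sphere hz0)
        have hca : c.1 < a.1 := (hBd c hc).trans_le hba
        rw [e, ih _ (hBd c hc) c rfl (by rintro rfl; exact lt_irrefl _ hca) hca.le w hw, smul_zero]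
  have hRball : ∀ z ∈ closedBall (0 : Fin a.1 → ℝ) 1,
      R (charMap a z) = (1 - ‖z‖) • (z, 1) := by
    intro z hz
    rw [hRa z hz]
    by_cases hz1 : ‖z‖ ≤ 1 / 2
    · rw [max_eq_left (by linarith), zero_smul, zero_add]
    · have hz0 : z ≠ 0 := by
        rintro rfl
        norm_num at hz1
      obtain ⟨B, -, hBd, hBb⟩ := exists_finite_boundary a
      obtain ⟨c, hc, w, hw, e⟩ := hBb _ (norm_inv_smul_mem_sphere hz0)
      have hca : c.1 < a.1 := hBd c hc
      rw [e, hlow _ c rfl (by rintro rfl; exact lt_irrefl _ hca) hca.le w hw, smul_zero, zero_add]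
  let r : X → Fin a.1 → ℝ := fun y => (R y).2⁻¹ • (R y).1
  have hstar : ∀ (n : ℕ) (b : Cells X), b.1 = n → ∀ z ∈ closedBall (0 : Fin b.1 → ℝ) 1,
      0 < (R (charMap b z)).2 → r (charMap b z) ∈ ball 0 1 ∧
        h (charMap b z) 1 = h (charMap a (r (charMap b z))) 1 := by
    intro n
    induction n using Nat.strong_induction_on with
    | _ n ih =>
      rintro b rfl z hz hpos
      by_cases hb : b = a
      · subst hb
        have h1 := hRball z hz
        rw [h1] at hpos
        have hpos' : 0 < 1 - ‖z‖ := by simpa using hpos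
        have hr : r (charMap b z) = z := by
          simp only [r, h1, Prod.smul_mk, smul_eq_mul, mul_one]
          rw [smul_smul, inv_mul_cancel₀ hpos'.ne', one_smul]
        rw [hr]
        exact ⟨mem_ball_zero_iff.2 (by linarith), rfl⟩
      · have h1 := hRb b hb z hz
        have hz1 : 1 / 2 < ‖z‖ := by
          by_contra hz1
          rw [h1, max_eq_left (by linarith), zero_smul] at hpos
          exact lt_irrefl _ hpos
        have hz0 : z ≠ 0 := by
          rintro rfl
          norm_num at hz1
        have hm : 0 < 2 * ‖z‖ - 1 := by linarith
        rw [max_eq_right hm.le] at h1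
        have hpos' : 0 < (R (charMap b (‖z‖⁻¹ • z))).2 := by
          rw [h1] at hpos
          exact pos_of_mul_pos_right hpos hm.le
        have hr : r (charMap b z) = r (charMap b (‖z‖⁻¹ • z)) := by
          simp only [r, h1, Prod.smul_fst, Prod.smul_snd, smul_eq_mul, smul_smul]
          congr 1
          field_simp
        obtain ⟨B, -, hBd, hBb⟩ := exists_finite_boundary b
        obtain ⟨c, hc, w, hw, e⟩ := hBb _ (norm_inv_smul_mem_sphere hz0)
        rw [hr, hrad b z hz hz1.le, e]
        rw [e] at hpos'
        exact ih _ (hBd c hc) c rfl w hw hpos'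
  have hmem : ∀ y, 0 < (R y).2 → r y ∈ ball 0 1 ∧ h y 1 = h (charMap a (r y)) 1 := by
    intro y hy
    obtain ⟨b, z, hz, rfl⟩ := exists_eq_charMap y
    exact hstar _ b rfl z hz hy
  refine ⟨a, {y | 0 < (R y).2}, r, isOpen_lt continuous_const (by fun_prop), ?_, ?_,
    fun y hy => (hmem y hy).1, fun y hy => (hmem y hy).2⟩
  · rw [hx, mem_ofPred_eq, hRball _ (ball_subset_closedBall hz₀)]
    simpa using mem_ball_zero_iff.1 hz₀
  · refine ContinuousOn.smul (f := fun y => (R y).2⁻¹) (ContinuousOn.inv₀ (by fun_prop) ?_)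
      (by fun_prop)
    intro y hy
    exact ne_of_gt hy

theorem quotient_trans_right_cancel {Z : Type*} [TopologicalSpace Z] {x y z : Z}
    {α β : Path.Homotopic.Quotient x y} {γ : Path.Homotopic.Quotient y z}
    (h : α.trans γ = β.trans γ) : α = β := by
  have h1 := congrArg (fun δ => δ.trans γ.symm) h
  simpa only [Path.Homotopic.Quotient.trans_assoc, Path.Homotopic.Quotient.trans_symm,
    Path.Homotopic.Quotient.trans_refl] using h1

/-- The final map of the deformation sends two paths in `V` to images of paths in an open ball,
which are homotopic. The tracks of the endpoints under the deformation are common to both paths and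
cancel. -/
theorem hasHomotopicPathsNhds [T2Space X] : HasHomotopicPathsNhds X := by
  obtain ⟨h, hh, hh0, -, hV⟩ := exists_deformation (X := X)
  intro x
  obtain ⟨a, V, r, hVo, hxV, hr, hrV, hk⟩ := hV x
  refine ⟨V, hVo, hxV, fun y z p q hp hq => ?_⟩
  let H : C(I × X, X) := ⟨fun t => h t.2 t.1, by fun_prop⟩
  let h₁ : C(X, X) := ⟨fun x => h x 1, by fun_prop⟩
  let F : (ContinuousMap.id X).Homotopy h₁ :=
    { toContinuousMap := H
      map_zero_left := fun x => hh0 x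
      map_one_left := fun x => rfl }
  have : ContractibleSpace (ball (0 : Fin a.1 → ℝ) 1) :=
    (convex_ball _ _).contractibleSpace ⟨0, by simp⟩
  let k : ball (0 : Fin a.1 → ℝ) 1 → X := fun z => h (charMap a z) 1
  have hkc : Continuous k := by
    have h1 : Continuous fun z : ball (0 : Fin a.1 → ℝ) 1 => charMap a z :=
      (continuousOn_charMap a).comp_continuous continuous_subtype_val
        fun z => ball_subset_closedBall z.2
    exact h₁.continuous.comp h1
  have hlift : ∀ p : Path y z, (∀ t, p t ∈ V) → ∃ P : Path
      (⟨r y, hrV y (by simpa using hp 0)⟩ : ball (0 : Fin a.1 → ℝ) 1)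
      ⟨r z, hrV z (by simpa using hp 1)⟩, ∀ t, p.map h₁.continuous t = P.map hkc t := by
    intro p hp
    refine ⟨⟨⟨fun t => ⟨r (p t), hrV _ (hp t)⟩, ?_⟩, ?_, ?_⟩, fun t => hk _ (hp t)⟩
    · exact (hr.comp_continuous p.continuous hp).subtype_mk _
    · simp
    · simp
  obtain ⟨P, hP⟩ := hlift p hp
  obtain ⟨P', hP'⟩ := hlift q hq
  have hPP : (p.map h₁.continuous).Homotopic (q.map h₁.continuous) := by
    have hy : h₁ y = k ⟨r y, hrV y (by simpa using hp 0)⟩ := hk y (by simpa using hp 0)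
    have hz : h₁ z = k ⟨r z, hrV z (by simpa using hp 1)⟩ := hk z (by simpa using hp 1)
    have e1 : p.map h₁.continuous = (P.map hkc).cast hy hz := Path.ext (funext hP)
    have e2 : q.map h₁.continuous = (P'.map hkc).cast hy hz := Path.ext (funext hP')
    rw [e1, e2]
    exact ((SimplyConnectedSpace.paths_homotopic P P').map ⟨k, hkc⟩).pathCast hy hz
  have hp1 := Path.Homotopic.Quotient.eq.2 (Path.Homotopic.map_trans_evalAt F p)
  have hq1 := Path.Homotopic.Quotient.eq.2 (Path.Homotopic.map_trans_evalAt F q)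
  have hPP' := Path.Homotopic.Quotient.eq.2 hPP
  rw [Path.Homotopic.Quotient.mk_trans, Path.Homotopic.Quotient.mk_trans] at hp1 hq1
  exact Path.Homotopic.Quotient.eq.1 (quotient_trans_right_cancel
    (γ := Path.Homotopic.Quotient.mk (F.evalAt z)) (hp1.trans ((congrArg _ hPP').trans hq1.symm)))

end Topology.CWComplex

/-! ### Lifting maps from contractible spaces. -/

namespace IsCoveringMap

variable {E X A : Type*} [TopologicalSpace E] [TopologicalSpace X] [TopologicalSpace A] {p : E → X}

/-- Lift the homotopy `f ∘ D` from the constant map at `e₀` and take its end. The track of `a₀` lies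
over a single point, so it is constant. -/
theorem exists_lift_of_contraction (cov : IsCoveringMap p) (D : C(I × A, A)) {a₀ : A}
    (hD0 : ∀ a, D (0, a) = a₀) (hD1 : ∀ a, D (1, a) = a) (hDa : ∀ t, D (t, a₀) = a₀) (f : C(A, X))
    {e₀ : E} (he : p e₀ = f a₀) : ∃ F : C(A, E), (∀ a, p (F a) = f a) ∧ F a₀ = e₀ := by
  have h0 : ∀ a, (f.comp D) (0, a) = p ((ContinuousMap.const A e₀) a) := fun a => by
    simp [hD0, he]
  let H := cov.liftHomotopy (f.comp D) (ContinuousMap.const A e₀) h0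
  have hH : ∀ q, p (H q) = f (D q) := congrFun (cov.liftHomotopy_lifts (f.comp D) _ h0)
  refine ⟨⟨fun a => H (1, a), by fun_prop⟩, fun a => ?_, ?_⟩
  · change p (H (1, a)) = f a
    rw [hH, hD1]
  · have h1 : H (1, a₀) = H (0, a₀) := by
      refine cov.const_of_comp (g := fun t => H (t, a₀)) (by fun_prop) (fun t t' => ?_) 1 0
      rw [hH, hH, hDa, hDa]
    exact h1.trans (cov.liftHomotopy_zero _ _ h0 a₀)

theorem exists_lift_closedBall (cov : IsCoveringMap p) {W : Type*} [NormedAddCommGroup W]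
    [NormedSpace ℝ W] {f : W → X} (hf : ContinuousOn f (Metric.closedBall 0 1)) {e₀ : E}
    (he : p e₀ = f 0) : ∃ F : W → E, ContinuousOn F (Metric.closedBall 0 1) ∧
      (∀ z ∈ Metric.closedBall (0 : W) 1, p (F z) = f z) ∧ F 0 = e₀ := by
  classical
  let B := Metric.closedBall (0 : W) 1
  have hmem : ∀ q : I × B, (q.1 : ℝ) • (q.2 : W) ∈ B := by
    rintro ⟨t, z, hz⟩
    rw [mem_closedBall_zero_iff] at hz ⊢
    rw [norm_smul, Real.norm_of_nonneg t.2.1]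
    exact mul_le_one₀ t.2.2 (norm_nonneg _) hz
  let D : C(I × B, B) := ⟨fun q => ⟨(q.1 : ℝ) • (q.2 : W), hmem q⟩, by fun_prop⟩
  obtain ⟨F, hF, hF0⟩ := cov.exists_lift_of_contraction D (a₀ := ⟨0, by simp [B]⟩)
    (fun a => Subtype.ext (zero_smul ℝ (a : W))) (fun a => Subtype.ext (one_smul ℝ (a : W)))
    (fun t => Subtype.ext (smul_zero (t : ℝ)))
    ⟨fun z => f z, hf.comp_continuous continuous_subtype_val fun z => z.2⟩ he
  let F' : W → E := fun z => if h : z ∈ B then F ⟨z, h⟩ else e₀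
  have hF' : ∀ z (hz : z ∈ B), F' z = F ⟨z, hz⟩ := fun z hz => dif_pos hz
  refine ⟨F', ?_, fun z hz => ?_, ?_⟩
  · rw [continuousOn_iff_continuous_domRestrict]
    exact F.continuous.congr fun z => (hF' z z.2).symm
  · rw [hF' z hz]
    exact hF _
  · rw [hF' 0 (Metric.mem_closedBall_self zero_le_one)]
    exact hF0

end IsCoveringMap

/-! ### Homotopy groups of coverings and of contractible spaces. -/

section HomotopyGroups

variable {E X : Type*} [TopologicalSpace E] [TopologicalSpace X] {p : E → X}

theorem subsingleton_homotopyGroup_iff {N : Type*} {x : X} :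
    Subsingleton (HomotopyGroup N X x) ↔
      ∀ f : GenLoop N X x, GenLoop.Homotopic f GenLoop.const := by
  constructor
  · intro h f
    exact Quotient.exact (Subsingleton.elim (α := HomotopyGroup N X x) ⟦f⟧ ⟦GenLoop.const⟧)
  · intro h
    refine ⟨fun a b => ?_⟩
    induction a using Quotient.inductionOn with | _ f =>
    induction b using Quotient.inductionOn with | _ g =>
    exact Quotient.sound ((h f).trans (h g).symm)

/-- The homotopy groups of a simply connected covering space vanish if those of the base vanish in
degrees at least two. -/
theorem IsCoveringMap.subsingleton_homotopyGroup [SimplyConnectedSpace E] (cov : IsCoveringMap p)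
    (hX : ∀ r : ℕ, 2 ≤ r → ∀ x : X, Subsingleton (HomotopyGroup.Pi r X x)) (N : ℕ) (e : E) :
    Subsingleton (HomotopyGroup.Pi N E e) := by
  rcases N with _ | _ | N
  · exact HomotopyGroup.pi0EquivZerothHomotopy.subsingleton
  · exact HomotopyGroup.pi1EquivFundamentalGroup.subsingleton
  · have hN := subsingleton_homotopyGroup_iff.1 (hX (N + 2) (by omega) (p e))
    refine subsingleton_homotopyGroup_iff.2 fun f => ?_
    let pc : C(E, X) := ⟨p, cov.continuous⟩
    have h0 : (fun _ => 0 : Fin (N + 2) → I) ∈ Cube.boundary (Fin (N + 2)) := ⟨0, Or.inl rfl⟩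
    refine (cov.homotopicRel_iff_comp ⟨_, h0, f.2 _ h0⟩).2 ?_
    exact hN ⟨pc.comp f.1, fun y hy => congrArg p (f.2 y hy)⟩

/-- The lift to a covering space of a map on the cube that is constant on the boundary. -/
theorem IsCoveringMap.exists_lift_genLoop (cov : IsCoveringMap p) {r : ℕ} (hr : 2 ≤ r) {a : E}
    (f : GenLoop (Fin r) X (p a)) : ∃ g : GenLoop (Fin r) E a, ∀ y, p (g y) = f y := by
  have : NeZero r := ⟨by omega⟩
  let D : C(I × (Fin r → I), Fin r → I) := ⟨fun q i => q.1 * q.2 i, by fun_prop⟩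
  have hzero : (fun _ => 0 : Fin r → I) ∈ Cube.boundary (Fin r) := ⟨0, Or.inl rfl⟩
  obtain ⟨F, hF, hF0⟩ := cov.exists_lift_of_contraction D (a₀ := fun _ => 0)
    (fun y => funext fun i => zero_mul _) (fun y => funext fun i => one_mul _)
    (fun t => funext fun i => mul_zero _) f.1 (f.2 _ hzero).symm
  have hpath : ∀ γ : C(I, Fin r → I), (∀ t, γ t ∈ Cube.boundary (Fin r)) →
      F (γ 1) = F (γ 0) := by
    intro γ hγ
    refine cov.const_of_comp (g := fun t => F (γ t)) (by fun_prop) (fun t t' => ?_) 1 0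
    rw [hF, hF]
    exact (f.2 _ (hγ t)).trans (f.2 _ (hγ t')).symm
  refine ⟨⟨F, fun y hy => ?_⟩, hF⟩
  obtain ⟨i, hi⟩ := hy
  obtain ⟨j, hji⟩ : ∃ j : Fin r, j ≠ i := by
    have : Nontrivial (Fin r) := Fin.nontrivial_iff_two_le.2 hr
    exact exists_ne i
  -- Since r ≥ 2, a boundary point can be joined to the origin inside the boundary: slide coordinate
  -- `j` to 0 with `y i` fixed, then shrink within the face where coordinate `j` is 0.
  have h1 := hpath ⟨fun t => Function.update y j (t * y j), by fun_prop⟩ fun t =>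
    ⟨i, by simpa [hji.symm] using hi⟩
  have h2 := hpath ⟨fun t k => t * Function.update y j 0 k, by fun_prop⟩ fun t =>
    ⟨j, Or.inl (by simp)⟩
  simp only [ContinuousMap.coe_mk, one_mul, zero_mul, Function.update_eq_self] at h1 h2
  rw [h1, h2, hF0]

theorem prod_unitInterval_mem {N : ℕ} (d : Fin N → I) : ∏ i, (d i : ℝ) ∈ Set.Icc (0 : ℝ) 1 :=
  ⟨Finset.prod_nonneg fun i _ => (d i).2.1,
    Finset.prod_le_one (fun i _ => (d i).2.1) fun i _ => (d i).2.2⟩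

/-- The homotopy groups of a space vanish at a point to which the space contracts. -/
theorem subsingleton_homotopyGroup_of_contraction {N : ℕ} {a : E} (c : C(E × I, E))
    (hc0 : ∀ x, c (x, 0) = a) (hc1 : ∀ x, c (x, 1) = x) :
    Subsingleton (HomotopyGroup.Pi N E a) := by
  refine subsingleton_homotopyGroup_iff.2 fun f => ?_
  -- The contraction may move the base point `a`, so a collar is needed: `κ` squeezes the cube into
  -- its middle third, while `δ` is 1 there and falls to 0 at the ends.
  let κ : C(I, I) := ⟨fun s => Set.projIcc 0 1 zero_le_one (3 * (s : ℝ) - 1),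
    continuous_projIcc.comp (by fun_prop)⟩
  let δ : C(I, I) := ⟨fun s => Set.projIcc 0 1 zero_le_one (3 * min (s : ℝ) (1 - s)),
    continuous_projIcc.comp (by fun_prop)⟩
  have hκ0 : κ 0 = 0 := Set.projIcc_of_le_left zero_le_one (by norm_num)
  have hκ1 : κ 1 = 1 := Set.projIcc_of_right_le zero_le_one (by norm_num)
  have hδ0 : δ 0 = 0 := Set.projIcc_of_le_left zero_le_one (by norm_num)
  have hδ1 : δ 1 = 0 := Set.projIcc_of_le_left zero_le_one (by norm_num)
  have hκδ : ∀ s, κ s = 0 ∨ κ s = 1 ∨ δ s = 1 := by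
    intro s
    by_cases h1 : 3 * (s : ℝ) - 1 ≤ 0
    · exact Or.inl (Set.projIcc_of_le_left zero_le_one h1)
    by_cases h2 : 1 ≤ 3 * (s : ℝ) - 1
    · exact Or.inr (Or.inl (Set.projIcc_of_right_le zero_le_one h2))
    refine Or.inr (Or.inr (Set.projIcc_of_right_le zero_le_one ?_))
    rw [mul_min_of_nonneg _ _ (by norm_num : (0 : ℝ) ≤ 3)]
    exact le_min (by linarith) (by linarith)
  let μ : C(Fin N → I, I) := ⟨fun y => ⟨∏ i, (δ (y i) : ℝ), prod_unitInterval_mem _⟩, by fun_prop⟩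
  have hμ0 : ∀ y ∈ Cube.boundary (Fin N), μ y = 0 := by
    rintro y ⟨i, hi⟩
    refine Subtype.ext (Finset.prod_eq_zero (Finset.mem_univ i) ?_)
    rcases hi with hi | hi <;> simp [hi, hδ0, hδ1]
  let k : C(Fin N → I, Fin N → I) := ⟨fun y i => κ (y i), by fun_prop⟩
  have hkb : ∀ y ∈ Cube.boundary (Fin N), k y ∈ Cube.boundary (Fin N) := by
    rintro y ⟨i, hi⟩
    refine ⟨i, ?_⟩
    rcases hi with hi | hi
    · exact Or.inl (by simp [k, hi, hκ0])
    · exact Or.inr (by simp [k, hi, hκ1])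
  have hμ1 : ∀ y, k y ∈ Cube.boundary (Fin N) ∨ μ y = 1 := by
    intro y
    by_cases h : k y ∈ Cube.boundary (Fin N)
    · exact Or.inl h
    · refine Or.inr (Subtype.ext ?_)
      change ∏ i, (δ (y i) : ℝ) = 1
      refine Finset.prod_eq_one fun i _ => ?_
      rcases hκδ (y i) with h1 | h1 | h1
      · exact absurd ⟨i, Or.inl h1⟩ h
      · exact absurd ⟨i, Or.inr h1⟩ h
      · rw [h1]
        rfl
  let f₁ : C(Fin N → I, E) := f.1.comp k
  -- After contracting the middle, only the track of `a` traversed in the collar remains; it is then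
  -- retracted along itself.
  let f₂ : C(Fin N → I, E) := ⟨fun y => c (a, σ (μ y)), by fun_prop⟩
  have s1 : f.1.HomotopicRel f₁ (Cube.boundary (Fin N)) :=
    ⟨{ toFun := fun q => f.1 fun i => Set.Icc.convexComb (q.2 i) (κ (q.2 i)) q.1
       continuous_toFun := by
         refine f.1.continuous.comp (continuous_pi fun i => ?_)
         have h : Continuous fun q : I × (Fin N → I) => (q.2 i, κ (q.2 i), q.1) := by fun_prop
         exact Set.Icc.continuous_convexComb_prod.comp h
       map_zero_left := fun y => by simp
       map_one_left := fun y => by simp [f₁, k]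
       prop' := by
         rintro t y ⟨i, hi⟩
         refine (f.2 _ ⟨i, ?_⟩).trans (f.2 y ⟨i, hi⟩).symm
         rcases hi with hi | hi
         · exact Or.inl (by simp [hi, hκ0])
         · exact Or.inr (by simp [hi, hκ1]) }⟩
  have s2 : f₁.HomotopicRel f₂ (Cube.boundary (Fin N)) :=
    ⟨{ toFun := fun q => c (f₁ q.2, max (σ q.1) (σ (μ q.2)))
       continuous_toFun := by fun_prop
       map_zero_left := fun y => by
         change c (f₁ y, max (σ 0) (σ (μ y))) = f₁ y
         rw [unitInterval.symm_zero, max_eq_left unitInterval.le_one', hc1]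
       map_one_left := fun y => by
         rcases hμ1 y with h | h
         · have : f₁ y = a := f.2 _ h
           simp [this, f₂]
         · simp [h, hc0, f₂]
       prop' := by
         intro t y hy
         change c (f₁ y, max (σ t) (σ (μ y))) = f₁ y
         rw [hμ0 y hy, unitInterval.symm_zero, max_eq_right unitInterval.le_one', hc1] }⟩
  have s3 : f₂.HomotopicRel (GenLoop.const (N := Fin N) (x := a)).1 (Cube.boundary (Fin N)) :=
    ⟨{ toFun := fun q => c (a, σ (μ q.2 * σ q.1))
       continuous_toFun := by fun_prop
       map_zero_left := fun y => by simp [f₂]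
       map_one_left := fun y => by
         simp [hc1, GenLoop.const]
       prop' := by
         intro t y hy
         change c (a, σ (μ y * σ t)) = c (a, σ (μ y))
         simp [hμ0 y hy] }⟩
  exact (s1.trans s2).trans s3

/-- If a covering space contracts to each of its points, then the homotopy groups of the base in
degrees at least two vanish. -/
theorem IsCoveringMap.subsingleton_homotopyGroup_base (cov : IsCoveringMap p)
    (hp : Function.Surjective p)
    (hE : ∀ a : E, ∃ c : C(E × I, E), (∀ x, c (x, 0) = a) ∧ ∀ x, c (x, 1) = x)
    {r : ℕ} (hr : 2 ≤ r) (x : X) : Subsingleton (HomotopyGroup.Pi r X x) := by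
  obtain ⟨a, rfl⟩ := hp x
  obtain ⟨c, hc0, hc1⟩ := hE a
  have h := subsingleton_homotopyGroup_iff.1
    (subsingleton_homotopyGroup_of_contraction (N := r) c hc0 hc1)
  refine subsingleton_homotopyGroup_iff.2 fun f => ?_
  obtain ⟨g, hg⟩ := cov.exists_lift_genLoop hr f
  let pc : C(E, X) := ⟨p, cov.continuous⟩
  have h1 : (pc.comp g.1).HomotopicRel (pc.comp (GenLoop.const (N := Fin r) (x := a)).1)
      (Cube.boundary (Fin r)) := (h g).map fun H => H.compContinuousMap pc
  have h2 : pc.comp g.1 = f.1 := ContinuousMap.ext hg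
  rw [h2] at h1
  exact h1

end HomotopyGroups

/-! ### The value one means a global section. -/

section Secat

variable {E : Type u} {Y : Type v} {B : Type w}
  [TopologicalSpace E] [TopologicalSpace Y] [TopologicalSpace B]

/-- The invariant `secatTilde` is one exactly if there is a global section. -/
theorem secatTilde_eq_one_iff {p : E → Y} {q : Y → B} :
    secatTilde p q = 1 ↔ ∃ s : C(Y, E), ∀ y, p (s y) = y := by
  constructor
  · intro h
    have hne : {m : ℕ∞ | ∃ k : ℕ, m = (k : ℕ∞) ∧ 1 ≤ k ∧ ∃ U : Fin k → Set B,
        (∀ i, IsOpen (U i)) ∧ (⋃ i, U i) = Set.univ ∧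
          ∀ i, ∃ s : C(q ⁻¹' U i, E), ∀ y : q ⁻¹' U i, p (s y) = y}.Nonempty := by
      by_contra hne
      rw [secatTilde, Set.not_nonempty_iff_eq_empty.1 hne, sInf_empty] at h
      exact absurd h (by decide)
    obtain ⟨k, hk, -, U, -, hU, hs⟩ := csInf_mem hne
    rw [show sInf _ = (1 : ℕ∞) from h] at hk
    obtain rfl : k = 1 := by exact_mod_cast hk.symm
    obtain ⟨s, hs⟩ := hs 0
    have hmem : ∀ y, y ∈ q ⁻¹' U 0 := fun y => by
      have : q y ∈ ⋃ i, U i := hU ▸ Set.mem_univ _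
      obtain ⟨i, hi⟩ := Set.mem_iUnion.1 this
      rwa [Subsingleton.elim i 0] at hi
    exact ⟨s.comp ⟨fun y => ⟨y, hmem y⟩, by fun_prop⟩, fun y => hs ⟨y, hmem y⟩⟩
  · rintro ⟨s, hs⟩
    refine le_antisymm (sInf_le ⟨1, rfl, le_rfl, fun _ => Set.univ, fun _ => isOpen_univ,
      Set.iUnion_const _, fun _ => ⟨s.comp ⟨Subtype.val, continuous_subtype_val⟩,
        fun y => hs y⟩⟩) (le_sInf ?_)
    rintro _ ⟨k, rfl, hk, -⟩
    exact_mod_cast hk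

end Secat

theorem gridPoint_zero {n : ℕ} (hn : 0 < n) : gridPoint n ⟨0, hn⟩ = 0 :=
  Subtype.ext (by simp [gridPoint])

theorem gridPoint_last {n : ℕ} (hn : 2 ≤ n) : gridPoint n ⟨n - 1, by omega⟩ = 1 := by
  refine Subtype.ext ?_
  have h : (n : ℝ) - 1 ≠ 0 := by
    have : (2 : ℝ) ≤ n := by exact_mod_cast hn
    linarith
  simp [gridPoint, Nat.cast_sub (show 1 ≤ n by omega), div_self h]

/-! ### From a section to asphericity. -/

namespace UniversalCover

variable {X : Type u} [TopologicalSpace X] {x₀ : X} [PathConnectedSpace X]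
  [LocallyPathConnectedSpace X]

/-- A section of `pathEvaluation` contracts the universal cover to each of its points. -/
theorem exists_contraction_of_section (hX : HasHomotopicPathsNhds X) {n : ℕ} (hn : 2 ≤ n)
    (s : C(DiagonalQuotient n X x₀, PathQuotient X x₀))
    (hs : ∀ y, pathEvaluation n X x₀ (s y) = y) (a : UniversalCover X x₀) :
    ∃ c : C(UniversalCover X x₀ × I, UniversalCover X x₀),
      (∀ x, c (x, 0) = a) ∧ ∀ x, c (x, 1) = x := by
  let j : Fin n := ⟨n - 1, by omega⟩
  let F : C(UniversalCover X x₀, Fin n → UniversalCover X x₀) :=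
    ⟨fun x => Function.update (fun _ => a) j x, by fun_prop⟩
  let S : UniversalCover X x₀ → PathQuotient X x₀ := fun x => s (Quotient.mk'' (F x))
  have hS : Continuous S := s.continuous.comp (continuous_quot_mk.comp F.continuous)
  -- A representative passes through the prescribed points up to one group element, which is divided
  -- out.
  have hω : ∀ x, ∃ ω : C(I, UniversalCover X x₀), Quotient.mk'' ω = S x ∧
      ∀ i, ω (gridPoint n i) = F x i := by
    intro x
    obtain ⟨ω, hω⟩ := Quotient.exists_rep (S x)
    have h1 := hs (Quotient.mk'' (F x))
    change pathEvaluation n X x₀ (S x) = _ at h1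
    rw [← hω] at h1
    obtain ⟨g, hg⟩ := Quotient.exact h1
    refine ⟨g⁻¹ • ω, ?_, fun i => ?_⟩
    · rw [← hω]
      exact Quotient.sound ⟨g⁻¹, rfl⟩
    · have := congrFun hg i
      change g • F x i = ω (gridPoint n i) at this
      change g⁻¹ • ω (gridPoint n i) = F x i
      rw [← this, inv_smul_smul]
  choose ω hωS hωF using hω
  have h0 : ∀ x, ω x 0 = a := fun x => by
    rw [← gridPoint_zero (n := n) (by omega), hωF]
    have hj : (⟨0, by omega⟩ : Fin n) ≠ j := fun h => by
      have : 0 = n - 1 := congrArg Fin.val h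
      omega
    simp [F, hj]
  have h1 : ∀ x, ω x 1 = x := fun x => by
    rw [← gridPoint_last hn, hωF]
    simp [F, j]
  obtain ⟨W, hW, hWd⟩ := (isQuotientCoveringMap_proj (x₀ := x₀) hX).disjoint a
  -- The orbit map on paths is open, so for `x'` near `x` some translate of `ω x'` is close to `ω x`
  -- and starts near `a`. As `ω x'` itself starts at `a`, the translation is trivial.
  have hc : Continuous ω := by
    refine continuous_iff_continuousAt.2 fun x => ?_
    rw [ContinuousAt, Filter.tendsto_def]
    intro N hN
    obtain ⟨W', hW'W, hW', haW'⟩ := mem_nhds_iff.1 hW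
    obtain ⟨N', hN'N, hN', hxN'⟩ := mem_nhds_iff.1 hN
    let O : Set C(I, UniversalCover X x₀) := N' ∩ {γ | γ 0 ∈ W'}
    have hO : IsOpen O := hN'.inter (hW'.preimage (continuous_eval_const 0))
    have hO' : IsOpen ((Quotient.mk'' : _ → PathQuotient X x₀) '' O) :=
      isOpenMap_quotient_mk'_mul _ hO
    have hx : S x ∈ (Quotient.mk'' : _ → PathQuotient X x₀) '' O :=
      ⟨ω x, ⟨hxN', by simpa [h0] using haW'⟩, hωS x⟩
    filter_upwards [(hO'.preimage hS).mem_nhds hx] with x' hx'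
    obtain ⟨γ, ⟨hγN, hγW⟩, hγ⟩ := hx'
    rw [← hωS x'] at hγ
    obtain ⟨g, hg⟩ := Quotient.exact hγ
    have hg' : g • ω x' = γ := hg
    have hg1 : g = 1 := by
      refine hWd g ⟨g • a, ⟨a, mem_of_mem_nhds hW, rfl⟩, hW'W ?_⟩
      rw [← hg'] at hγW
      change g • ω x' 0 ∈ W' at hγW
      rwa [h0] at hγW
    rw [hg1, one_smul] at hg'
    exact hN'N (hg' ▸ hγN)
  exact ⟨⟨fun q => ω q.1 q.2, by fun_prop⟩, h0, h1⟩

theorem isAspherical_of_tcTilde_eq_one (hX : HasHomotopicPathsNhds X) {n : ℕ} (hn : 2 ≤ n)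
    (h : tcTilde n X x₀ = 1) : IsAspherical X := by
  obtain ⟨s, hs⟩ := secatTilde_eq_one_iff.1 h
  refine ⟨inferInstance, fun r hr x => ?_⟩
  exact (isQuotientCoveringMap_proj (x₀ := x₀) hX).isCoveringMap.subsingleton_homotopyGroup_base
    surjective_proj (exists_contraction_of_section hX hn s hs) hr x

end UniversalCover

/-! ### Properness of the deck action and uniqueness of local lifts. -/

namespace IsQuotientCoveringMap

open Metric Set Topology.CWComplex

variable {G E X : Type*} [Group G] [TopologicalSpace E] [TopologicalSpace X] [MulAction G E]
  {p : E → X}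

theorem smul_left_injective (hp : IsQuotientCoveringMap p G) {g h : G} {a : E}
    (H : g • a = h • a) : g = h :=
  have := hp.isCancelSMul
  IsCancelSMul.right_cancel _ _ _ H

theorem exists_smul_eq (hp : IsQuotientCoveringMap p G) {a b : E} (h : p a = p b) :
    ∃ g : G, g • b = a :=
  hp.apply_eq_iff_mem_orbit.1 h

theorem finite_setOf_smul_eq [T2Space X] (hp : IsQuotientCoveringMap p G) {K K' : Set E}
    (hK : IsCompact K) (hK' : IsCompact K') :
    {g : G | ∃ a ∈ K, ∃ b ∈ K', g • a = b}.Finite := by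
  have := hp.toContinuousConstSMul
  let P : Set (E × E) → Prop := fun S => {g : G | ∃ q ∈ S, g • q.1 = q.2}.Finite
  have h : P (K ×ˢ K') := by
    refine (hK.prod hK').induction_on ?_ ?_ ?_ ?_
    · simp [P]
    · exact fun s t hst ht => ht.subset fun g ⟨q, hq, e⟩ => ⟨q, hst hq, e⟩
    · refine fun s t hs ht => (hs.union ht).subset ?_
      rintro g ⟨q, hq | hq, e⟩
      · exact Or.inl ⟨q, hq, e⟩
      · exact Or.inr ⟨q, hq, e⟩
    · rintro ⟨a, b⟩ -
      suffices H : ∃ t ∈ 𝓝 (a, b), P t by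
        obtain ⟨t, ht, h⟩ := H
        exact ⟨t, mem_nhdsWithin_of_mem_nhds ht, h⟩
      by_cases hab : p b = p a
      · obtain ⟨g₀, rfl⟩ := hp.exists_smul_eq hab
        obtain ⟨U, hU, hUd⟩ := hp.disjoint a
        have hU' : (g₀⁻¹ • ·) ⁻¹' U ∈ 𝓝 (g₀ • a) :=
          (continuous_const_smul g₀⁻¹).continuousAt.preimage_mem_nhds (by simpa using hU)
        refine ⟨U ×ˢ ((g₀⁻¹ • ·) ⁻¹' U), prod_mem_nhds hU hU', (finite_singleton g₀).subset ?_⟩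
        rintro g ⟨⟨x, y⟩, ⟨hx, hy⟩, e⟩
        have h1 : g₀⁻¹ * g = 1 := hUd _ ⟨(g₀⁻¹ * g) • x, ⟨x, hx, rfl⟩, by
          have e' : g • x = y := e
          rw [mul_smul, e']
          exact hy⟩
        exact (inv_mul_eq_one.1 h1).symm
      · obtain ⟨S, T, hS, hT, haS, hbT, hd⟩ := t2_separation (Ne.symm hab)
        have hc := hp.continuous
        refine ⟨(p ⁻¹' S) ×ˢ (p ⁻¹' T), prod_mem_nhds ((hS.preimage hc).mem_nhds haS)
          ((hT.preimage hc).mem_nhds hbT), finite_empty.subset ?_⟩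
        rintro g ⟨⟨x, y⟩, ⟨hx, hy⟩, e⟩
        have e' : g • x = y := e
        have : p y = p x := by rw [← e', hp.map_smul]
        exact disjoint_left.1 hd hx (this ▸ hy : p x ∈ T)
  exact h.subset fun g ⟨a, ha, b, hb, e⟩ => ⟨(a, b), ⟨ha, hb⟩, e⟩

/-- Two maps into a covering space with the same projection agree near a point where they agree. -/
theorem eventually_eq_of_eq (hp : IsQuotientCoveringMap p G) {Z : Type*} [TopologicalSpace Z]
    {f g : Z → E} {z : Z} (hf : ContinuousAt f z) (hg : ContinuousAt g z)
    (h : ∀ᶠ y in 𝓝 z, p (f y) = p (g y)) (hz : f z = g z) : ∀ᶠ y in 𝓝 z, f y = g y := by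
  obtain ⟨U, hU, hUd⟩ := hp.disjoint (f z)
  filter_upwards [h, hf hU, hg (hz ▸ hU)] with y hy h1 h2
  obtain ⟨γ, hγ⟩ := hp.exists_smul_eq hy
  have : γ = 1 := hUd γ ⟨f y, ⟨g y, h2, hγ⟩, h1⟩
  rw [← hγ, this, one_smul]

end IsQuotientCoveringMap

/-! ### Product cells on the square of a covering. -/

namespace Topology.CWComplex

open Metric Set

variable {G E X : Type*} [Group G] [TopologicalSpace E] [TopologicalSpace X] [MulAction G E]
  [CWComplex (univ : Set X)] {p : E → X}

theorem exists_lift_charMap (hp : IsQuotientCoveringMap p G) :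
    ∃ Φ : ∀ a : Cells X, (Fin a.1 → ℝ) → E, (∀ a, ContinuousOn (Φ a) (closedBall 0 1)) ∧
      ∀ a : Cells X, ∀ z ∈ closedBall (0 : Fin a.1 → ℝ) 1, p (Φ a z) = charMap a z := by
  have h : ∀ a : Cells X, ∃ F : (Fin a.1 → ℝ) → E, ContinuousOn F (closedBall 0 1) ∧
      ∀ z ∈ closedBall (0 : Fin a.1 → ℝ) 1, p (F z) = charMap a z := fun a => by
    obtain ⟨e, he⟩ := hp.surjective (charMap a 0)
    obtain ⟨F, h1, h2, -⟩ := hp.isCoveringMap.exists_lift_closedBall (continuousOn_charMap a) he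
    exact ⟨F, h1, h2⟩
  choose Φ h1 h2 using h
  exact ⟨Φ, h1, h2⟩

/-- By properness only finitely many translates of each lifted closed cell meet `K`. -/
theorem exists_finite_cover_of_isCompact [T2Space X] (hp : IsQuotientCoveringMap p G)
    {Φ : ∀ a : Cells X, (Fin a.1 → ℝ) → E} (hΦ : ∀ a, ContinuousOn (Φ a) (closedBall 0 1))
    (hpΦ : ∀ a : Cells X, ∀ z ∈ closedBall (0 : Fin a.1 → ℝ) 1, p (Φ a z) = charMap a z)
    {K : Set E} (hK : IsCompact K) {F : Set (Cells X)} (hF : F.Finite)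
    (hKF : ∀ x ∈ K, ∃ b ∈ F, p x ∈ charMap b '' closedBall 0 1) :
    ∃ F' : Set (G × Cells X), F'.Finite ∧ (∀ b ∈ F', b.2 ∈ F) ∧
      ∀ x ∈ K, ∃ b ∈ F', ∃ w ∈ closedBall (0 : Fin b.2.1 → ℝ) 1, x = b.1 • Φ b.2 w := by
  let D : Cells X → Set G := fun c =>
    {g | ∃ a ∈ Φ c '' closedBall 0 1, ∃ b ∈ K, g • a = b}
  refine ⟨⋃ c ∈ F, (fun g => (g, c)) '' D c, hF.biUnion fun c _ => ?_, ?_, fun x hx => ?_⟩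
  · exact (hp.finite_setOf_smul_eq ((isCompact_closedBall _ _).image_of_continuousOn (hΦ c))
      hK).image _
  · intro b hb
    simp only [mem_iUnion] at hb
    obtain ⟨c, hc, g, -, rfl⟩ := hb
    exact hc
  · obtain ⟨c, hc, w, hw, e⟩ := hKF x hx
    rw [← hpΦ c w hw] at e
    obtain ⟨g, hg⟩ := hp.exists_smul_eq e.symm
    exact ⟨(g, c), mem_biUnion hc ⟨g, ⟨_, ⟨w, hw, rfl⟩, x, hx, hg⟩, rfl⟩, w, hw, hg.symm⟩

/-- The cells of the square of a covering space of a CW complex. -/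
def squareCells [T2Space X] (hp : IsQuotientCoveringMap p G)
    {Φ : ∀ a : Cells X, (Fin a.1 → ℝ) → E} (hΦ : ∀ a, ContinuousOn (Φ a) (closedBall 0 1))
    (hpΦ : ∀ a : Cells X, ∀ z ∈ closedBall (0 : Fin a.1 → ℝ) 1, p (Φ a z) = charMap a z) :
    EquivariantCells G (E × E) fun a : Cells X × Cells X × G =>
      (Fin a.1.1 → ℝ) × (Fin a.2.1.1 → ℝ) where
  -- The product of the `g`-translate of cell `a` and the `h`-translate of cell `b` is `g` applied
  -- to the cell of index (a, b, g⁻¹h). The sup norm makes the unit ball of the product a product of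
  -- balls.
  dim a := a.1.1 + a.2.1.1
  map a z := (Φ a.1 z.1, a.2.2 • Φ a.2.1 z.2)
  continuousOn a := by
    have := hp.toContinuousConstSMul
    have h : ∀ z ∈ closedBall (0 : (Fin a.1.1 → ℝ) × (Fin a.2.1.1 → ℝ)) 1,
        z.1 ∈ closedBall 0 1 ∧ z.2 ∈ closedBall 0 1 := fun z hz => by
      simp only [mem_closedBall_zero_iff] at hz ⊢
      exact max_le_iff.1 hz
    exact ((hΦ a.1).comp continuousOn_fst fun z hz => (h z hz).1).prodMk
      (((hΦ a.2.1).comp continuousOn_snd fun z hz => (h z hz).2).const_smul a.2.2)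
  exists_eq := by
    rintro ⟨x, y⟩
    obtain ⟨a, z, hz, hx⟩ := exists_eq_charMap (p x)
    obtain ⟨b, w, hw, hy⟩ := exists_eq_charMap (p y)
    rw [← hpΦ a z hz] at hx
    rw [← hpΦ b w hw] at hy
    obtain ⟨g, rfl⟩ := hp.exists_smul_eq hx
    obtain ⟨h, rfl⟩ := hp.exists_smul_eq hy
    refine ⟨g, (a, b, g⁻¹ * h), (z, w), ?_, ?_⟩
    · rw [mem_closedBall_zero_iff] at hz hw ⊢
      exact max_le hz hw
    · simp [mul_smul]
  unique := by
    rintro g g' ⟨a, b, k⟩ ⟨a', b', k'⟩ ⟨z, w⟩ ⟨z', w'⟩ h h' e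
    rw [mem_ball_zero_iff] at h h'
    obtain ⟨hz, hw⟩ := max_lt_iff.1 h
    obtain ⟨hz', hw'⟩ := max_lt_iff.1 h'
    rw [← mem_ball_zero_iff] at hz hw hz' hw'
    have e1 : g • Φ a z = g' • Φ a' z' := congrArg Prod.fst e
    have e2 : g • k • Φ b w = g' • k' • Φ b' w' := congrArg Prod.snd e
    have h1 := charMap_injective hz hz' (by
      rw [← hpΦ a z (ball_subset_closedBall hz), ← hpΦ a' z' (ball_subset_closedBall hz'),
        ← hp.map_smul g, e1, hp.map_smul])
    have h2 := charMap_injective hw hw' (by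
      rw [← hpΦ b w (ball_subset_closedBall hw), ← hpΦ b' w' (ball_subset_closedBall hw'),
        ← hp.map_smul k, ← hp.map_smul g, e2, hp.map_smul, hp.map_smul])
    cases h1
    cases h2
    have h3 : g = g' := hp.smul_left_injective e1
    subst h3
    have h4 : k = k' := hp.smul_left_injective (smul_left_cancel g e2)
    subst h4
    rfl
  boundary := by
    have := hp.toContinuousConstSMul
    rintro ⟨a, b, k⟩
    have hS : ∀ c : Cells X, ∃ F : Set (G × Cells X), F.Finite ∧ (∀ d ∈ F, d.2.1 < c.1) ∧
        ∀ z ∈ sphere (0 : Fin c.1 → ℝ) 1, ∃ d ∈ F, ∃ w ∈ closedBall (0 : Fin d.2.1 → ℝ) 1,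
          Φ c z = d.1 • Φ d.2 w := by
      intro c
      obtain ⟨F, hF, hFd, hFc⟩ := exists_finite_boundary c
      obtain ⟨F', hF', hF'F, h⟩ := exists_finite_cover_of_isCompact hp hΦ hpΦ
        ((isCompact_sphere (0 : Fin c.1 → ℝ) 1).image_of_continuousOn
          ((hΦ c).mono sphere_subset_closedBall)) hF (by
            rintro _ ⟨z, hz, rfl⟩
            obtain ⟨d, hd, w, hw, e⟩ := hFc z hz
            exact ⟨d, hd, w, hw, by rw [hpΦ c z (sphere_subset_closedBall hz), e]⟩)
      exact ⟨F', hF', fun d hd => hFd _ (hF'F d hd), fun z hz => h _ ⟨z, hz, rfl⟩⟩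
    obtain ⟨F, hF, hFd, hFa⟩ := hS a
    obtain ⟨F', hF', hFd', hFb⟩ := hS b
    refine ⟨(fun d : G × Cells X => (d.1, d.2, b, d.1⁻¹ * k)) '' F ∪
      (fun d : G × Cells X => (1, a, d.2, k * d.1)) '' F', (hF.image _).union (hF'.image _),
      ?_, ?_⟩
    · rintro _ (⟨d, hd, rfl⟩ | ⟨d, hd, rfl⟩)
      · exact Nat.add_lt_add_right (hFd d hd) _
      · exact Nat.add_lt_add_left (hFd' d hd) _
    · rintro ⟨z, w⟩ hzw
      have h0 : max ‖z‖ ‖w‖ = 1 := mem_sphere_zero_iff_norm.1 hzw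
      have hz : ‖z‖ ≤ 1 := h0 ▸ le_max_left _ _
      have hw : ‖w‖ ≤ 1 := h0 ▸ le_max_right _ _
      rcases max_choice ‖z‖ ‖w‖ with h | h
      · obtain ⟨d, hd, x, hx, e⟩ := hFa z (mem_sphere_zero_iff_norm.2 (h ▸ h0))
        refine ⟨_, Or.inl ⟨d, hd, rfl⟩, (x, w), ?_, ?_⟩
        · rw [mem_closedBall_zero_iff] at hx ⊢
          exact max_le hx hw
        · simp [e, mul_smul]
      · obtain ⟨d, hd, x, hx, e⟩ := hFb w (mem_sphere_zero_iff_norm.2 (h ▸ h0))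
        refine ⟨_, Or.inr ⟨d, hd, rfl⟩, (z, x), ?_, ?_⟩
        · rw [mem_closedBall_zero_iff] at hx ⊢
          exact max_le hz hx
        · simp [e, mul_smul]

end Topology.CWComplex

/-! ### Extending families of paths over a ball. -/

section PathExtension

open Metric Set

theorem exists_continuousOn_curry {T Z E : Type*} [TopologicalSpace T] [TopologicalSpace Z]
    [TopologicalSpace E] [Nonempty E] {B : Set Z} {f : T × Z → E}
    (hf : ContinuousOn f (univ ×ˢ B)) :
    ∃ ψ : Z → C(T, E), ContinuousOn ψ B ∧ ∀ z ∈ B, ∀ t, ψ z t = f (t, z) := by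
  classical
  let F : C(B × T, E) := ⟨fun q => f (q.2, q.1), hf.comp_continuous (by fun_prop)
    fun q => ⟨mem_univ _, q.1.2⟩⟩
  let ψ : Z → C(T, E) := fun z => if h : z ∈ B then F.curry ⟨z, h⟩ else
    ContinuousMap.const T (Classical.arbitrary E)
  have hψ : ∀ z (h : z ∈ B), ψ z = F.curry ⟨z, h⟩ := fun z h => dif_pos h
  refine ⟨ψ, ?_, fun z hz t => ?_⟩
  · rw [continuousOn_iff_continuous_domRestrict]
    exact F.curry.continuous.congr fun z => (hψ z z.2).symm
  · rw [hψ z hz]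
    rfl

/-- The endpoints `m` on the two end faces and the paths `φ` on the side form a map `f` on the
boundary of [-1,1] × ball, the unit sphere of ℝ × V. A filling of it is the extended family. -/
theorem exists_path_extension {E : Type*} [TopologicalSpace E] [Nonempty E] {N : ℕ} {V : Type*}
    [NormedAddCommGroup V] [NormedSpace ℝ V] (e : V ≃ᵢ (Fin N → ℝ)) (he : e 0 = 0)
    (hE : ∀ y : E, Subsingleton (HomotopyGroup.Pi N E y)) {m : V → E × E}
    (hm : ContinuousOn m (closedBall 0 1)) {φ : V → C(I, E)} (hφ : ContinuousOn φ (sphere 0 1))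
    (h : ∀ z ∈ sphere (0 : V) 1, (φ z 0, φ z 1) = m z) :
    ∃ ψ : V → C(I, E), ContinuousOn ψ (closedBall 0 1) ∧
      (∀ z ∈ closedBall (0 : V) 1, (ψ z 0, ψ z 1) = m z) ∧ EqOn ψ φ (sphere 0 1) := by
  classical
  let c : ℝ → I := fun t => projIcc 0 1 zero_le_one ((t + 1) / 2)
  have hc : Continuous c := continuous_projIcc.comp (by fun_prop)
  have hc0 : c (-1) = 0 := projIcc_of_le_left zero_le_one (by norm_num)
  have hc1 : c 1 = 1 := projIcc_of_right_le zero_le_one (by norm_num)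
  let f : ℝ × V → E := fun w =>
    if w.1 = -1 then (m w.2).1 else if w.1 = 1 then (m w.2).2 else φ w.2 (c w.1)
  have hf0 : ∀ z, f (-1, z) = (m z).1 := fun z => if_pos rfl
  have hf1 : ∀ z, f (1, z) = (m z).2 := fun z => by
    have : (1 : ℝ) ≠ -1 := by norm_num
    simp [f, this]
  have hfφ : ∀ t, ∀ z ∈ sphere (0 : V) 1, f (t, z) = φ z (c t) := by
    intro t z hz
    have hmz := h z hz
    by_cases h0 : t = -1
    · rw [h0, hf0, ← hmz, hc0]
    by_cases h1 : t = 1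
    · rw [h1, hf1, ← hmz, hc1]
    simp [f, h0, h1]
  let S (t : ℝ) : Set (ℝ × V) := {t} ×ˢ closedBall 0 1
  let S' : Set (ℝ × V) := univ ×ˢ sphere 0 1
  have hS : ∀ t, IsClosed (S t) := fun t => isClosed_singleton.prod isClosed_closedBall
  have hS' : IsClosed S' := isClosed_univ.prod isClosed_sphere
  have hms : ∀ t, ContinuousOn (fun w : ℝ × V => m w.2) (S t) := fun t =>
    hm.comp continuousOn_snd fun w hw => hw.2
  have hf : ContinuousOn f (sphere 0 1) := by
    have h0 : ContinuousOn f (S (-1)) := (hms _).fst.congr fun w hw => by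
      obtain ⟨t, z⟩ := w
      obtain ⟨rfl, -⟩ := hw
      exact hf0 z
    have h1 : ContinuousOn f (S 1) := (hms _).snd.congr fun w hw => by
      obtain ⟨t, z⟩ := w
      obtain ⟨rfl, -⟩ := hw
      exact hf1 z
    have h2 : ContinuousOn f S' := by
      have : ContinuousOn (fun w : ℝ × V => φ w.2) S' :=
        hφ.comp continuousOn_snd fun w hw => hw.2
      exact (this.eval (hc.comp continuous_fst).continuousOn).congr fun w hw => hfφ w.1 w.2 hw.2
    refine ((h0.union_of_isClosed h1 (hS _) (hS _)).union_of_isClosed h2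
      ((hS _).union (hS _)) hS').mono ?_
    rintro ⟨t, z⟩ hw
    have hn : max ‖t‖ ‖z‖ = 1 := mem_sphere_zero_iff_norm.1 hw
    have hz : z ∈ closedBall (0 : V) 1 := mem_closedBall_zero_iff.2 (hn ▸ le_max_right _ _)
    rcases max_choice ‖t‖ ‖z‖ with h | h
    · rw [hn, Real.norm_eq_abs] at h
      rcases eq_or_eq_neg_of_abs_eq h.symm with rfl | rfl
      · exact Or.inl (Or.inr ⟨rfl, hz⟩)
      · exact Or.inl (Or.inl ⟨rfl, hz⟩)
    · exact Or.inr ⟨mem_univ _, mem_sphere_zero_iff_norm.2 (h ▸ hn)⟩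
  obtain ⟨F, hF, hFf⟩ := exists_extend_sphere_of_subsingleton_homotopyGroup e he hE hf
  have habs : ∀ t : I, |2 * (t : ℝ) - 1| ≤ 1 := fun t =>
    abs_le.2 ⟨by linarith [t.2.1], by linarith [t.2.2]⟩
  obtain ⟨ψ, hψ, hψF⟩ := exists_continuousOn_curry (T := I) (B := closedBall (0 : V) 1)
    (f := fun q => F (2 * (q.1 : ℝ) - 1, q.2)) (hF.comp (by fun_prop) fun q hq => by
      rw [mem_closedBall_zero_iff]
      exact max_le (habs q.1) (mem_closedBall_zero_iff.1 hq.2))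
  refine ⟨ψ, hψ, fun z hz => ?_, fun z hz => ContinuousMap.ext fun t => ?_⟩
  · have hs : ∀ t : ℝ, |t| = 1 → (t, z) ∈ sphere (0 : ℝ × V) 1 := fun t ht =>
      mem_sphere_zero_iff_norm.2 ((max_eq_left (by
        rw [Real.norm_eq_abs, ht]
        exact mem_closedBall_zero_iff.1 hz)).trans ht)
    have e0 : (2 * ((0 : I) : ℝ) - 1) = -1 := by norm_num
    have e1 : (2 * ((1 : I) : ℝ) - 1) = 1 := by norm_num
    rw [hψF z hz, hψF z hz]
    simp only [e0, e1]
    rw [hFf _ (hs _ (by norm_num)), hFf _ (hs _ (by norm_num)), hf0, hf1]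
  · rw [hψF z (sphere_subset_closedBall hz)]
    have hz' : ‖z‖ = 1 := mem_sphere_zero_iff_norm.1 hz
    change F (2 * (t : ℝ) - 1, z) = φ z t
    rw [hFf _ (mem_sphere_zero_iff_norm.2 ((max_eq_right (by
      rw [hz']
      exact habs t)).trans hz')), hfφ _ z hz]
    refine congrArg (φ z) ?_
    change projIcc 0 1 zero_le_one ((2 * (t : ℝ) - 1 + 1) / 2) = t
    rw [show (2 * (t : ℝ) - 1 + 1) / 2 = t by ring]
    exact projIcc_val _ t

end PathExtension

/-! ### Equivariant paths, continuous on compact pieces. -/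

namespace Topology.CWComplex

open Metric Set

variable {G E X : Type*} [Group G] [TopologicalSpace E] [TopologicalSpace X] [MulAction G E]
  [ContinuousConstSMul G E] [CWComplex (univ : Set X)] {p : E → X}

/-- A choice of paths between any two points of a covering space of a CW complex which has
vanishing homotopy groups. It is equivariant, and continuous on compact sets of pairs of points
which lie over finitely many cells. -/
theorem exists_equivariant_paths [T2Space X] [T2Space E] [Nonempty E]
    (hp : IsQuotientCoveringMap p G)
    (hE : ∀ (N : ℕ) (y : E), Subsingleton (HomotopyGroup.Pi N E y)) :
    ∃ τ : E × E → C(I, E), (∀ y, (τ y 0, τ y 1) = y) ∧ (∀ (g : G) y, τ (g • y) = g • τ y) ∧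
      ∀ (K K' : Set E) (F F' : Set (Cells X)), IsCompact K → IsCompact K' → F.Finite →
        F'.Finite → (∀ x ∈ K, ∃ b ∈ F, p x ∈ charMap b '' closedBall 0 1) →
        (∀ x ∈ K', ∃ b ∈ F', p x ∈ charMap b '' closedBall 0 1) → ContinuousOn τ (K ×ˢ K') := by
  have : Nonempty C(I, E) := ⟨ContinuousMap.const I (Classical.arbitrary E)⟩
  obtain ⟨Φ, hΦ, hpΦ⟩ := exists_lift_charMap hp
  let 𝒞 := squareCells hp hΦ hpΦ
  obtain ⟨τ, h1, h2, h3⟩ := 𝒞.exists_equivariant_section (E := C(I, E))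
    (p := fun ω => (ω 0, ω 1)) (fun g ω => rfl) (fun _ _ => True) (fun a φ hφ h => by
      obtain ⟨ψ, hψ, hψm, hψφ⟩ := exists_path_extension (Fin.appendIsometry a.1.1 a.2.1.1)
        (by ext i; refine Fin.addCases (fun i => ?_) (fun i => ?_) i <;> simp)
        (hE _) (𝒞.continuousOn a) hφ h
      exact ⟨ψ, hψ, hψm, hψφ, trivial⟩)
  refine ⟨τ, h1, h2, fun K K' F F' hK hK' hF hF' hKF hKF' => ?_⟩
  obtain ⟨R, hR, -, hRK⟩ := exists_finite_cover_of_isCompact hp hΦ hpΦ hK hF hKF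
  obtain ⟨R', hR', -, hRK'⟩ := exists_finite_cover_of_isCompact hp hΦ hpΦ hK' hF' hKF'
  let j : (G × Cells X) × (G × Cells X) → G × Cells X × Cells X × G := fun q =>
    (q.1.1, q.1.2, q.2.2, q.1.1⁻¹ * q.2.1)
  refine (𝒞.continuousOn_iUnion_of_finite h2 ((hR.prod hR').image j)
    fun b _ => (h3 b.2).1).mono ?_
  rintro ⟨x, y⟩ ⟨hx, hy⟩
  obtain ⟨b, hb, z, hz, e⟩ := hRK x hx
  obtain ⟨b', hb', w, hw, e'⟩ := hRK' y hy
  refine mem_biUnion (mem_image_of_mem j (mk_mem_prod hb hb')) ⟨(z, w), ?_, ?_⟩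
  · rw [mem_closedBall_zero_iff] at hz hw ⊢
    exact max_le hz hw
  · have e1 : x = b.1 • Φ b.2 z := e
    have e2 : y = b'.1 • Φ b'.2 w := e'
    rw [e1, e2]
    simp [𝒞, squareCells, j, mul_smul]

end Topology.CWComplex

/-! ### Concatenating equivariant families of paths. -/

section EquivariantPaths

variable {G E Y : Type*} [Group G] [TopologicalSpace E] [MulAction G E] [TopologicalSpace Y]
  [MulAction G Y]

theorem exists_equivariant_trans {S T : Y → I → E} (hS : Continuous fun q : Y × I => S q.1 q.2)
    (hT : Continuous fun q : Y × I => T q.1 q.2) (hST : ∀ y, S y 1 = T y 0)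
    (hSG : ∀ (g : G) y t, S (g • y) t = g • S y t) (hTG : ∀ (g : G) y t, T (g • y) t = g • T y t) :
    ∃ R : Y → I → E, Continuous (fun q : Y × I => R q.1 q.2) ∧ (∀ y, R y 0 = S y 0) ∧
      (∀ y, R y 1 = T y 1) ∧ ∀ (g : G) y t, R (g • y) t = g • R y t := by
  let c : ℝ → I := Set.projIcc 0 1 zero_le_one
  have hc : Continuous c := continuous_projIcc
  have hc0 : c 0 = 0 := Set.projIcc_of_le_left zero_le_one le_rfl
  have hc1 : c 1 = 1 := Set.projIcc_of_right_le zero_le_one le_rfl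
  refine ⟨fun y t => if (t : ℝ) ≤ 1 / 2 then S y (c (2 * t)) else T y (c (2 * t - 1)), ?_,
    fun y => ?_, fun y => ?_, fun g y t => ?_⟩
  · refine Continuous.if_le (f' := fun q : Y × I => S q.1 (c (2 * q.2)))
      (g' := fun q : Y × I => T q.1 (c (2 * q.2 - 1))) ?_ ?_ (by fun_prop) (by fun_prop) ?_
    · exact hS.comp (by fun_prop : Continuous fun q : Y × I => (q.1, c (2 * q.2)))
    · exact hT.comp (by fun_prop : Continuous fun q : Y × I => (q.1, c (2 * q.2 - 1)))
    · rintro ⟨y, t⟩ h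
      have h' : (t : ℝ) = 1 / 2 := h
      simp [h', hc0, hc1, hST]
  · simp [hc0]
  · have h1 : ¬ ((1 : ℝ) ≤ 1 / 2) := by norm_num
    have h2 : (2 * 1 - 1 : ℝ) = 1 := by norm_num
    simp only [Set.Icc.coe_one, if_neg h1, h2, hc1]
  · beta_reduce
    split_ifs
    · exact hSG g y _
    · exact hTG g y _

/-- From an equivariant choice of paths between two points one obtains an equivariant choice of
paths through any sequence of points. -/
theorem exists_equivariant_path_through {ρ : E × E → I → E}
    (hρ : Continuous fun q : (E × E) × I => ρ q.1 q.2) (hρ0 : ∀ y, ρ y 0 = y.1)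
    (hρ1 : ∀ y, ρ y 1 = y.2) (hρG : ∀ (g : G) y t, ρ (g • y) t = g • ρ y t) (m : ℕ) :
    ∃ R : (ℕ → E) → ℝ → E, Continuous (fun q : (ℕ → E) × ℝ => R q.1 q.2) ∧
      (∀ x, ∀ k ≤ m, R x k = x k) ∧ ∀ (g : G) x t, R (g • x) t = g • R x t := by
  induction m with
  | zero =>
    refine ⟨fun x _ => x 0, by fun_prop, fun x k hk => ?_, fun g x t => rfl⟩
    rw [Nat.le_zero.1 hk]
  | succ m ih =>
    obtain ⟨R, hR, hRx, hRG⟩ := ih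
    let c : ℝ → I := Set.projIcc 0 1 zero_le_one
    have hc : Continuous c := continuous_projIcc
    have hc0 : c 0 = 0 := Set.projIcc_of_le_left zero_le_one le_rfl
    have hc1 : c 1 = 1 := Set.projIcc_of_right_le zero_le_one le_rfl
    -- Time is real, so that the point of index `k` is reached at time `k` and a new segment leaves
    -- the earlier ones unchanged.
    refine ⟨fun x t => if t ≤ m then R x t else ρ (x m, x (m + 1)) (c (t - m)), ?_,
      fun x k hk => ?_, fun g x t => ?_⟩
    · refine Continuous.if_le (f' := fun q : (ℕ → E) × ℝ => R q.1 q.2)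
        (g' := fun q : (ℕ → E) × ℝ => ρ (q.1 m, q.1 (m + 1)) (c (q.2 - m))) hR ?_
        (by fun_prop) (by fun_prop) ?_
      · exact hρ.comp (by fun_prop : Continuous fun q : (ℕ → E) × ℝ =>
          ((q.1 m, q.1 (m + 1)), c (q.2 - m)))
      · rintro ⟨x, t⟩ h
        have h' : t = m := h
        simp [h', hc0, hρ0, hRx x m le_rfl]
    · rcases Nat.le_succ_iff.1 hk with h | h
      · have : (k : ℝ) ≤ m := by exact_mod_cast h
        simp only [if_pos this]
        exact hRx x k h
      · subst h
        have h1 : ¬ (((m + 1 : ℕ) : ℝ) ≤ m) := by push_cast; linarith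
        have h2 : ((m + 1 : ℕ) : ℝ) - m = 1 := by push_cast; ring
        simp only [if_neg h1, h2, hc1, hρ1]
    · beta_reduce
      split_ifs
      · exact hRG g x t
      · exact hρG g (x m, x (m + 1)) _

end EquivariantPaths

/-! ### Lifting the deformation; globally continuous equivariant paths. -/

namespace Topology.CWComplex

open Metric Set

variable {G E X : Type*} [Group G] [TopologicalSpace E] [TopologicalSpace X] [MulAction G E]
  [ContinuousConstSMul G E] [CWComplex (univ : Set X)] {p : E → X}

/-- An equivariant homotopy of a covering space of a CW complex whose final map sends some
neighbourhood of every point to a compact set which lies over finitely many cells. -/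
theorem exists_equivariant_deformation [T2Space X] (hp : IsQuotientCoveringMap p G) :
    ∃ H : E → I → E, Continuous (fun q : E × I => H q.1 q.2) ∧ (∀ x, H x 0 = x) ∧
      (∀ (g : G) x t, H (g • x) t = g • H x t) ∧
      ∀ x, ∃ (K : Set E) (F : Set (Cells X)), IsCompact K ∧ F.Finite ∧
        (∀ y ∈ K, ∃ b ∈ F, p y ∈ charMap b '' closedBall 0 1) ∧ ∀ᶠ y in 𝓝 x, H y 1 ∈ K := by
  have cov := hp.isCoveringMap
  have hpc : Continuous p := hp.continuous
  obtain ⟨Φ, hΦ, hpΦ⟩ := exists_lift_charMap hp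
  obtain ⟨h, hh, hh0, hfin, hloc⟩ := exists_deformation (X := X)
  let f : C(I × E, X) := ⟨fun q => h (p q.2) q.1, by fun_prop⟩
  have hf0 : ∀ x, f (0, x) = p (ContinuousMap.id E x) := fun x => hh0 (p x)
  let L := cov.liftHomotopy f (ContinuousMap.id E) hf0
  have hL : ∀ q, p (L q) = h (p q.2) q.1 := congrFun (cov.liftHomotopy_lifts f _ hf0)
  have hL0 : ∀ x, L (0, x) = x := cov.liftHomotopy_zero f _ hf0
  have hLG : ∀ (g : G) x t, L (t, g • x) = g • L (t, x) := by
    intro g x t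
    refine congrFun (cov.eq_of_comp_eq (g₁ := fun t => L (t, g • x)) (g₂ := fun t => g • L (t, x))
      (by fun_prop) ((by fun_prop : Continuous fun t => L (t, x)).const_smul g)
      (funext fun t => ?_) 0 ?_) t
    · change p (L (t, g • x)) = p (g • L (t, x))
      rw [hp.map_smul, hL, hL, hp.map_smul]
    · rw [hL0, hL0]
  refine ⟨fun x t => L (t, x), by fun_prop, hL0, hLG, fun x => ?_⟩
  obtain ⟨a, V, r, hV, hxV, hr, hrV, hk⟩ := hloc (p x)
  obtain ⟨F, hF, hFa⟩ := hfin a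
  let k : (Fin a.1 → ℝ) → E := fun z => L (1, Φ a z)
  have hkc : ContinuousOn k (closedBall 0 1) :=
    (by fun_prop : Continuous fun e => L (1, e)).comp_continuousOn (hΦ a)
  have hpk : ∀ z ∈ closedBall (0 : Fin a.1 → ℝ) 1, p (k z) = h (charMap a z) 1 := fun z hz => by
    rw [hL, hpΦ a z hz]
  have hpr : ∀ y ∈ p ⁻¹' V, p (L (1, y)) = p (k (r (p y))) := fun y hy => by
    rw [hL, hpk _ (ball_subset_closedBall (hrV _ hy))]
    exact hk _ hy
  obtain ⟨g, hg⟩ := hp.exists_smul_eq (hpr x hxV)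
  have hVx : p ⁻¹' V ∈ 𝓝 x := (hV.preimage hpc).mem_nhds hxV
  have hkr : ContinuousAt (fun y => g • k (r (p y))) x := by
    have h1 : ContinuousOn (fun y => k (r (p y))) (p ⁻¹' V) :=
      hkc.comp (hr.comp hpc.continuousOn fun y hy => hy) fun y hy =>
        ball_subset_closedBall (hrV _ hy)
    exact (h1.continuousAt hVx).const_smul g
  refine ⟨(fun z => g • k z) '' closedBall 0 1, F,
    (isCompact_closedBall _ _).image_of_continuousOn (hkc.const_smul g), hF, ?_, ?_⟩
  · rintro _ ⟨z, hz, rfl⟩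
    obtain ⟨b, hb, h1⟩ := hFa z hz
    refine ⟨b, hb, ?_⟩
    rwa [hp.map_smul, hpk z hz]
  · have h1 := hp.eventually_eq_of_eq (f := fun y => L (1, y)) (g := fun y => g • k (r (p y)))
      (by fun_prop : Continuous fun y => L (1, y)).continuousAt hkr (by
        filter_upwards [hVx] with y hy
        rw [hp.map_smul]
        exact hpr y hy) hg.symm
    filter_upwards [h1, hVx] with y hy hyV
    rw [hy]
    exact ⟨_, ball_subset_closedBall (hrV _ hyV), rfl⟩

/-- Precomposing `τ` with the end of `H` in both variables lands locally in a product of compact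
sets on which `τ` is continuous. The tracks of `H` at both ends restore the original endpoints. -/
theorem exists_continuous_equivariant_paths [T2Space X] [T2Space E] [Nonempty E]
    (hp : IsQuotientCoveringMap p G)
    (hE : ∀ (N : ℕ) (y : E), Subsingleton (HomotopyGroup.Pi N E y)) :
    ∃ ρ : E × E → I → E, Continuous (fun q : (E × E) × I => ρ q.1 q.2) ∧ (∀ y, ρ y 0 = y.1) ∧
      (∀ y, ρ y 1 = y.2) ∧ ∀ (g : G) y t, ρ (g • y) t = g • ρ y t := by
  obtain ⟨τ, hτ, hτG, hτc⟩ := exists_equivariant_paths hp hE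
  obtain ⟨H, hH, hH0, hHG, hHK⟩ := exists_equivariant_deformation hp
  let θ : E × E → C(I, E) := fun y => τ (H y.1 1, H y.2 1)
  have hH1 : Continuous fun x => H x 1 :=
    hH.comp (by fun_prop : Continuous fun x : E => (x, (1 : I)))
  have hθ : Continuous θ := by
    refine continuous_iff_continuousAt.2 fun ⟨x, y⟩ => ?_
    obtain ⟨K, F, hK, hF, hKF, hxK⟩ := hHK x
    obtain ⟨K', F', hK', hF', hKF', hyK'⟩ := hHK y
    have h1 := hτc K K' F F' hK hK' hF hF' hKF hKF'
    have h2 : ∀ᶠ q : E × E in 𝓝 (x, y), (H q.1 1, H q.2 1) ∈ K ×ˢ K' := by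
      rw [nhds_prod_eq]
      exact hxK.prod_mk hyK'
    refine (h1 (H x 1, H y 1) h2.self_of_nhds).tendsto.comp
      (tendsto_nhdsWithin_iff.2 ⟨?_, h2⟩)
    exact ((hH1.comp continuous_fst).prodMk (hH1.comp continuous_snd)).continuousAt
  have hθ0 : ∀ y, θ y 0 = H y.1 1 := fun y => congrArg Prod.fst (hτ _)
  have hθ1 : ∀ y, θ y 1 = H y.2 1 := fun y => congrArg Prod.snd (hτ _)
  have hθG : ∀ (g : G) y t, θ (g • y) t = g • θ y t := fun g y t => by
    change τ (H (g • y.1) 1, H (g • y.2) 1) t = _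
    rw [hHG, hHG]
    exact congrArg (fun ω : C(I, E) => ω t) (hτG g (H y.1 1, H y.2 1))
  obtain ⟨R, hR, hR0, hR1, hRG⟩ := exists_equivariant_trans (G := G) (Y := E × E)
    (S := fun y => H y.1) (T := fun y t => θ y t)
    (hH.comp (by fun_prop : Continuous fun q : (E × E) × I => (q.1.1, q.2))) (by fun_prop)
    (fun y => (hθ0 y).symm) (fun g y t => hHG g y.1 t) hθG
  obtain ⟨ρ, hρ, hρ0, hρ1, hρG⟩ := exists_equivariant_trans (G := G) (Y := E × E)
    (S := R) (T := fun y t => H y.2 (unitInterval.symm t)) hR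
    (hH.comp (by fun_prop : Continuous fun q : (E × E) × I => (q.1.2, unitInterval.symm q.2)))
    (fun y => by rw [hR1, hθ1, unitInterval.symm_zero]) hRG (fun g y t => hHG g y.2 _)
  refine ⟨ρ, hρ, fun y => ?_, fun y => ?_, hρG⟩
  · rw [hρ0, hR0, hH0]
  · rw [hρ1, unitInterval.symm_one, hH0]

end Topology.CWComplex

/-! ### From asphericity to a global section, and the equivalence. -/

theorem Topology.CWComplex.tcTilde_eq_one_of_isAspherical {X : Type u} [TopologicalSpace X]
    [T2Space X] [CWComplex (Set.univ : Set X)] (h : IsAspherical X) (x₀ : X) {n : ℕ}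
    (hn : 2 ≤ n) : tcTilde n X x₀ = 1 := by
  have := h.1
  have := locallyPathConnectedSpace (X := X)
  have hX := hasHomotopicPathsNhds (X := X)
  have hp := UniversalCover.isQuotientCoveringMap_proj (x₀ := x₀) hX
  have := UniversalCover.t2Space (x₀ := x₀) hX
  have := UniversalCover.simplyConnectedSpace (x₀ := x₀) hX
  obtain ⟨ρ, hρ, hρ0, hρ1, hρG⟩ := exists_continuous_equivariant_paths hp
    (hp.isCoveringMap.subsingleton_homotopyGroup h.2)
  obtain ⟨R, hR, hRx, hRG⟩ := exists_equivariant_path_through hρ hρ0 hρ1 hρG (n - 1)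
  let E := UniversalCover X x₀
  -- The tuple becomes a sequence by repeating its last entry. Rescaling time by n - 1 then sends
  -- the grid points to 0, …, n - 1.
  let e : (Fin n → E) → ℕ → E := fun x k => x ⟨min k (n - 1), by omega⟩
  let S : C(Fin n → E, C(I, E)) := ContinuousMap.curry
    ⟨fun q => R (e q.1) (q.2 * ((n : ℝ) - 1)), hR.comp
      (by fun_prop : Continuous fun q : (Fin n → E) × I => (e q.1, (q.2 : ℝ) * ((n : ℝ) - 1)))⟩
  have hS : ∀ x t, S x t = R (e x) (t * ((n : ℝ) - 1)) := fun x t => rfl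
  have hSG : ∀ (g : FundamentalGroup X x₀) x, S (g • x) = g • S x := fun g x =>
    ContinuousMap.ext fun t => hRG g (e x) _
  have hSx : ∀ x (j : Fin n), S x (gridPoint n j) = x j := by
    intro x j
    have h1 : (n : ℝ) - 1 ≠ 0 := by
      have : (2 : ℝ) ≤ n := by exact_mod_cast hn
      linarith
    have h2 : (gridPoint n j : ℝ) * ((n : ℝ) - 1) = (j : ℕ) := div_mul_cancel₀ _ h1
    rw [hS, h2, hRx _ _ (by omega)]
    exact congrArg x (Fin.ext (min_eq_left (by omega)))
  refine secatTilde_eq_one_iff.2 ⟨⟨Quotient.map' S ?_, ?_⟩, fun y => ?_⟩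
  · rintro x x' ⟨g, rfl⟩
    exact ⟨g, (hSG g x').symm⟩
  · exact S.continuous.quotient_map' _
  · induction y using Quotient.inductionOn' with | _ x =>
    exact congrArg Quotient.mk'' (funext (hSx x))

theorem mainTheorem7 {X : Type*} [TopologicalSpace X] [T2Space X]
    [Topology.CWComplex (Set.univ : Set X)] [PathConnectedSpace X] (x₀ : X) :
    List.TFAE
      [∃ n : ℕ, 2 ≤ n ∧ tcTilde n X x₀ = 1,
        IsAspherical X,
        ∀ n : ℕ, 2 ≤ n → tcTilde n X x₀ = 1] := by
  have := Topology.CWComplex.locallyPathConnectedSpace (X := X)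
  tfae_have 1 → 2 := fun ⟨_, hn, h⟩ =>
    UniversalCover.isAspherical_of_tcTilde_eq_one Topology.CWComplex.hasHomotopicPathsNhds hn h
  tfae_have 2 → 3 := fun h _ hn => Topology.CWComplex.tcTilde_eq_one_of_isAspherical h x₀ hn
  tfae_have 3 → 1 := fun h => ⟨2, le_rfl, h 2 le_rfl⟩
  tfae_finish
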